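/- Let $n\ge 1$ and let $\mathbf s: d_1\le d_2\le\dots\le d_n$ be a tree degree sequence, i.e. a nondecreasing sequence of nonnegative integers with $\sum_{i=1}^n d_i=2n-2$ whose entries are all positive if $n>1$. Let $\mathcal T_{\mathbf s}$ be the set of all labelled trees on $n$ vertices whose vertex degrees, listed in nondecreasing order, are $d_1,\dots,d_n$. For a graph $T$ write $\nu(T)$ for its matching number, $\alpha(T)$ for its independence number and $\operatorname{null}(T)$ for the nullity of its adjacency matrix. Let $a=a(\mathbf s)$ be the annihilation number of $\mathbf s$: the largest $a\in\{0,\dots,n\}$ with $\sum_{i=1}^a d_i\le n-1$. Then the following extrema exist and $$\min_{T\in\mathcal T_{\mathbf s}}\nu(T)=n-a(\mathbf s),\qquad \max_{T\in\mathcal T_{\mathbf s}}\operatorname{null}(T)=2a(\mathbf s)-n,\qquad \max_{T\in\mathcal T_{\mathbf s}}\alpha(T)=a(\mathbf s).$$ Moreover, all three are attained by the graph $\mathrm{MNA}(\mathbf s)$ on $v_1,\dots,v_n$ built by the following maximum-nullity algorithm; in particular $\mathrm{MNA}(\mathbf s)\in\mathcal T_{\mathbf s}$. Let $l$ be the number of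 entries of $\mathbf s$ equal to $1$. Join $v_n$ to $v_1,\dots,v_{d_n}$ and put $t=d_n+1$, $k=d_n$, $h=n$, $i=1$, $V_K=\emptyset$. While $t<n$ repeat: 1. put $v_k$ into $V_K$, join $v_k$ to $v_{h-1},v_{h-2},\dots,v_{h-d_{l+i}+1}$, and add $d_{l+i}-1$ to $t$; 2. for $j=h-1,h-2,\dots,h-d_{l+i}+1$ in this order, as long as $t\neq n$: join $v_j$ to $v_{k+1},\dots,v_{k+d_j-1}$ and add $d_j-1$ to both $t$ and $k$; 3. subtract $d_{l+i}-1$ from $h$ and add $1$ to $i$. Finally, suppose $V_K\ne\emptyset$. Let $x$ and $y$ be the first and the last vertex put into $V_K$, and let $P$ be the path from $x$ to $y$ in $\mathrm{MNA}(\mathbf s)$. Consider the edge sets $M$ consisting of the first, third, fifth, … edge of $P$ (counted from $x$; no edge if $x=y$), one edge $vf(v)$ to a leaf $f(v)$ for each non-leaf $v\notin P$ that has a neighbour in $V_K$, and, if $y$ is adjacent to a leaf, one edge from $y$ to a leaf. Such an $M$ exists, and every such $M$ is a maximum matching of $\mathrm{MNA}(\mathbf s)$. -/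

import Mathlib

/-- A nondecreasing sequence `d₁ ≤ … ≤ dₙ` of vertex degrees is a tree degree sequence when its sum
is `2n - 2` and no entry is zero (except for the sequence `0` of the one-vertex tree). The sum is
written without subtraction, so `n = 0` is excluded. -/
structure IsTreeDegreeSequence {n : ℕ} (s : Fin n → ℕ) : Prop where
  mono : Monotone s
  sum_eq : ∑ i, s i + 2 = 2 * n
  pos : 1 < n → ∀ i, 0 < s i

open Classical in
/-- `G` has degree sequence `s`: the list of its vertex degrees is a rearrangement of `s`. -/
def HasDegreeSequence {n : ℕ} (G : SimpleGraph (Fin n)) (s : Fin n → ℕ) : Prop :=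
  Multiset.map (fun v => G.degree v) Finset.univ.val = Multiset.map s Finset.univ.val

/-- The set of all (labelled) trees with degree sequence `s`. -/
def treesWithDegrees {n : ℕ} (s : Fin n → ℕ) : Set (SimpleGraph (Fin n)) :=
  {T | T.IsTree ∧ HasDegreeSequence T s}

/-- The matching number: the largest number of edges in a matching. -/
noncomputable def matchingNumber {V : Type*} (G : SimpleGraph V) : ℕ :=
  sSup {k | ∃ M : G.Subgraph, M.IsMatching ∧ M.edgeSet.ncard = k}

open Classical in
/-- The nullity of a graph: the dimension of the kernel of its adjacency matrix over `ℝ`. -/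
noncomputable def graphNullity {V : Type*} [Fintype V] (G : SimpleGraph V) : ℕ :=
  Module.finrank ℝ (LinearMap.ker (G.adjMatrix ℝ).mulVecLin)

/-- The annihilation number of a degree sequence `d₁ ≤ … ≤ dₙ`: the largest `a ≤ n` with
`d₁ + … + d_a ≤ m`, where `m` is the number of edges, that is, `2m = d₁ + … + dₙ`. -/
def annihilationNumber {n : ℕ} (s : Fin n → ℕ) : ℕ :=
  Nat.findGreatest (fun a => 2 * ∑ i with i.val < a, s i ≤ ∑ i, s i) n

namespace MaxNullity

/-- The `j`-th entry `d_j` of the sequence, numbered from `1`. -/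
def entry {n : ℕ} (s : Fin n → ℕ) (j : ℕ) : ℕ :=
  if h : 1 ≤ j ∧ j ≤ n then s ⟨j - 1, by omega⟩ else 0

/-- The number of entries equal to `1`. -/
def numLeaves {n : ℕ} (s : Fin n → ℕ) : ℕ :=
  (Finset.univ.filter fun j => s j = 1).card

/-- The variables of the maximum-nullity algorithm. A number `j` stands for the vertex `v_j`,
`1 ≤ j ≤ n`; `t` is the number of vertices reached so far, `v_k` is the last vertex reached by
counting up from `v_1`, and `v_h` the last one reached by counting down from `v_n`; `VK` lists the
vertices of `V_K` in the order in which they are added. -/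
structure State where
  edges : List (ℕ × ℕ)
  t : ℕ
  k : ℕ
  i : ℕ
  h : ℕ
  VK : List ℕ

/-- The vertex `v_n` is joined to `v_1, …, v_{d_n}`. -/
def start {n : ℕ} (s : Fin n → ℕ) : State where
  edges := (List.range (entry s n)).map fun r => (n, r + 1)
  t := entry s n + 1
  k := entry s n
  i := 1
  h := n
  VK := []

/-- One pass of the inner loop: `v_j` is joined to `v_{k+1}, …, v_{k+d_j-1}`. Nothing is done once
all `n` vertices are reached. -/
def innerStep {n : ℕ} (s : Fin n → ℕ) (σ : State) (j : ℕ) : State :=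
  if σ.t = n then σ else
    { σ with
      edges := σ.edges ++ (List.range (entry s j - 1)).map fun r => (j, σ.k + 1 + r)
      t := σ.t + (entry s j - 1)
      k := σ.k + (entry s j - 1) }

/-- The indices `h-1, h-2, …, h-c+1`, in this order. -/
def downFrom (h c : ℕ) : List ℕ :=
  (List.range (c - 1)).map fun r => h - 1 - r

/-- One pass of the outer loop, run only while `t < n`: `v_k` is put into `V_K` and joined to
`v_{h-1}, …, v_{h-c+1}`, where `c = d_{l+i}`; then the inner loop runs through these vertices in
this order. -/
def outerStep {n : ℕ} (s : Fin n → ℕ) (σ : State) : State :=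
  if σ.t < n then
    let c := entry s (numLeaves s + σ.i)
    let H := downFrom σ.h c
    let σ₁ : State :=
      { σ with
        VK := σ.VK ++ [σ.k]
        edges := σ.edges ++ H.map fun j => (σ.k, j)
        t := σ.t + (c - 1) }
    let σ₂ := H.foldl (innerStep s) σ₁
    { σ₂ with h := σ.h - (c - 1), i := σ.i + 1 }
  else σ

/-- The final state. Every pass of the outer loop increases `t`, so `n` passes are enough. -/
def run {n : ℕ} (s : Fin n → ℕ) : State :=
  (outerStep s)^[n] (start s)

/-- The graph on `v_1, …, v_n` returned by the algorithm; `x : Fin n` is the vertex `v_{x+1}`. -/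
def tree {n : ℕ} (s : Fin n → ℕ) : SimpleGraph (Fin n) :=
  SimpleGraph.fromRel fun x y => (x.val + 1, y.val + 1) ∈ (run s).edges

/-- The set `V_K` returned by the algorithm. -/
def setVK {n : ℕ} (s : Fin n → ℕ) : Set (Fin n) :=
  {x | x.val + 1 ∈ (run s).VK}

/-- `v` is a leaf adjacent to `u`. -/
def IsLeafAt {V : Type*} (G : SimpleGraph V) (u v : V) : Prop :=
  G.Adj u v ∧ (G.neighborSet v).ncard = 1

/-- `M` is a matching that accompanies the output when `V_K` is not empty. Let `P` be the path from
the first vertex `x` of `V_K` to the last one `y`. Then `M` consists of the first, third, fifth, …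
edge of `P`, one edge to a leaf at each internal vertex `v ∉ P` that has a neighbour in `V_K`, and
one edge to a leaf at `y` if `y` is adjacent to a leaf; `f` chooses these leaves. -/
def IsAlgorithmMatching {n : ℕ} (s : Fin n → ℕ) (M : Set (Sym2 (Fin n))) : Prop :=
  ∃ (x y : Fin n) (P : (tree s).Walk x y) (f : Fin n → Fin n),
    (run s).VK.head? = some (x.val + 1) ∧ (run s).VK.getLast? = some (y.val + 1) ∧ P.IsPath ∧
    let VJ : Set (Fin n) :=
      {v | (∃ u ∈ setVK s, (tree s).Adj u v) ∧ v ∉ P.support ∧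
        1 < ((tree s).neighborSet v).ncard}
    let S : Set (Fin n) := VJ ∪ {v | v = y ∧ ∃ u, IsLeafAt (tree s) y u}
    (∀ v ∈ S, IsLeafAt (tree s) v (f v)) ∧
    M = {e | ∃ i, 2 * i + 1 ≤ P.length ∧ e = s(P.getVert (2 * i), P.getVert (2 * i + 1))} ∪
      {e | ∃ v ∈ S, e = s(v, f v)}

end MaxNullity

/-! In a graph on `n` vertices a matching `M` and an independent set `I` satisfy `|M| + |I| ≤ n`,
because every edge has an end outside `I`. In a forest equality is attained, and the nullity equals
`2α - n`: isolating the neighbour of a leaf lowers the matching number by one and, by linear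
algebra, raises the nullity by at least two (`SimpleGraph.IsAcyclic.exists_matching_indepSet`,
`two_mul_card_le_graphNullity`). All three extrema thus reduce to maximising `α`. The degrees over
an independent set sum to at most the number of edges, so `α ≤ a(s)`
(`HasDegreeSequence.indepNum_le`). It remains to find an independent set of size `a(s)` in the
output of the algorithm.

With `excess s p = ∑_{j ≤ p} (d_j - 1)` the whole run has a closed form (`MaxNullity.Inv`). If `m`
vertices enter `V_K`, they receive the degrees `d_{l+1}, …, d_{l+m}`, and the vertices from `low = l
+ m + 1` upwards keep their own degrees. Every edge joins a bottom vertex, with index below `eta m`,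
to a top vertex, with index at least `eta m`. Each top vertex except `v_n` is a child of one hub
(member of `V_K`), and each bottom vertex is a child of one top vertex. The output is connected and
its degrees are at most those prescribed; counting edges forces it to be a tree with degree sequence
`s` (`Final.isTree_and_exists_perm`).

Always `eta m ≤ low`. If they are equal, the bottom is independent and has `l + m` elements.
Otherwise the vertices from `eta m` to `low - 1` are leaves at the last hub `y`; exchanging `y` for
them gives `l + m - 1` independent vertices. In both cases the closed form gives at least `a(s)`
(`Final.annihilationNumber_le`). The edge sets accompanying the output cover the complement of this
set, with no edge inside the complement, so they have the maximum size (`Final.card_le_ncard`). -/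

/-! ### Matchings against independent sets -/

/-- A set of pairwise disjoint edges of `G`. -/
def IsEdgeMatching {V : Type*} (G : SimpleGraph V) (M : Set (Sym2 V)) : Prop :=
  M ⊆ G.edgeSet ∧ ∀ e ∈ M, ∀ e' ∈ M, ∀ v, v ∈ e → v ∈ e' → e = e'

theorem IsEdgeMatching.exists_subgraph {V : Type*} {G : SimpleGraph V} {M : Set (Sym2 V)}
    (hM : IsEdgeMatching G M) : ∃ M' : G.Subgraph, M'.IsMatching ∧ M'.edgeSet = M := by
  refine ⟨⟨{v | ∃ e ∈ M, v ∈ e}, fun u v => s(u, v) ∈ M, fun {u v} h => hM.1 h,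
    fun {u v} h => ⟨_, h, by simp⟩, ⟨fun u v h => by rwa [Sym2.eq_swap]⟩⟩, ?_, ?_⟩
  · rintro v ⟨e, he, hv⟩
    obtain ⟨w, rfl⟩ := Sym2.mem_iff_exists.1 hv
    refine ⟨w, he, fun w' hw' => ?_⟩
    have := hM.2 _ he _ hw' v (by simp) (by simp)
    exact (Sym2.congr_right.1 this).symm
  · ext e
    induction e with
    | _ u v => rfl

theorem SimpleGraph.Subgraph.IsMatching.isEdgeMatching {V : Type*} {G : SimpleGraph V}
    {M : G.Subgraph} (hM : M.IsMatching) : IsEdgeMatching G M.edgeSet := by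
  refine ⟨M.edgeSet_subset, fun e he e' he' v hv hv' => ?_⟩
  obtain ⟨w, rfl⟩ := Sym2.mem_iff_exists.1 hv
  obtain ⟨w', rfl⟩ := Sym2.mem_iff_exists.1 hv'
  exact congrArg (s(v, ·)) (hM.eq_of_adj_left he he')

/-- Every edge of `M` has an end outside `I`; choosing one for each edge is injective because the
edges are disjoint. -/
theorem IsEdgeMatching.ncard_add_card_le {V : Type*} [Fintype V] {G : SimpleGraph V}
    {M : Set (Sym2 V)} (hM : IsEdgeMatching G M) {I : Finset V} (hI : G.IsIndepSet (I : Set V)) :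
    M.ncard + I.card ≤ Fintype.card V := by
  classical
  have key : ∀ e : Sym2 V, e ∈ M → ∃ v ∈ e, v ∉ I := by
    intro e he
    induction e with
    | _ u v =>
      by_contra! h
      have huv : G.Adj u v := hM.1 he
      exact hI (h u (by simp)) (h v (by simp)) huv.ne huv
  obtain ⟨g, hg, hgI⟩ : ∃ g : Sym2 V → V, (∀ e ∈ M, g e ∈ e) ∧ ∀ e ∈ M, g e ∉ I := by
    refine ⟨fun e => if h : e ∈ M then (key e h).choose else e.out.1, fun e he => ?_,
      fun e he => ?_⟩
    · simpa [he] using (key e he).choose_spec.1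
    · simpa [he] using (key e he).choose_spec.2
  have h1 : M.ncard ≤ (Iᶜ : Finset V).card := by
    rw [← Set.ncard_coe_finset]
    refine Set.ncard_le_ncard_of_injOn g (fun e he => by simpa using hgI e he) ?_ (Set.toFinite _)
    intro e he e' he' h
    exact hM.2 e he e' he' (g e) (hg e he) (h ▸ hg e' he')
  have h2 := Finset.card_add_card_compl I
  omega

theorem bddAbove_matching {V : Type*} [Fintype V] (G : SimpleGraph V) :
    BddAbove {k | ∃ M : G.Subgraph, M.IsMatching ∧ M.edgeSet.ncard = k} := by
  refine ⟨Fintype.card V, ?_⟩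
  rintro k ⟨M, hM, rfl⟩
  have := hM.isEdgeMatching.ncard_add_card_le (I := ∅) (by simp)
  simpa using this

theorem IsEdgeMatching.ncard_le {V : Type*} [Fintype V] {G : SimpleGraph V}
    {M : Set (Sym2 V)} (hM : IsEdgeMatching G M) : M.ncard ≤ matchingNumber G := by
  obtain ⟨M', h, rfl⟩ := hM.exists_subgraph
  exact le_csSup (bddAbove_matching G) ⟨M', h, rfl⟩

theorem matchingNumber_add_card_le {V : Type*} [Fintype V] {G : SimpleGraph V} {I : Finset V}
    (hI : G.IsIndepSet (I : Set V)) : matchingNumber G + I.card ≤ Fintype.card V := by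
  obtain ⟨M, hM, h⟩ := Nat.sSup_mem (s := {k | ∃ M : G.Subgraph, M.IsMatching ∧
    M.edgeSet.ncard = k}) ⟨0, ⊥, fun v hv => by simp at hv, by simp⟩ (bddAbove_matching G)
  rw [matchingNumber, ← h]
  exact hM.isEdgeMatching.ncard_add_card_le hI

/-! ### Bounds on the nullity -/

/-- The kernel of the adjacency matrix. -/
noncomputable def adjKer {V : Type*} [Fintype V] (G : SimpleGraph V) : Submodule ℝ (V → ℝ) :=
  open Classical in LinearMap.ker (G.adjMatrix ℝ).mulVecLin

open Classical in
theorem mem_adjKer {V : Type*} [Fintype V] {G : SimpleGraph V} {x : V → ℝ} :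
    x ∈ adjKer G ↔ ∀ v, ∑ w, (if G.Adj v w then x w else 0) = 0 := by
  simp only [adjKer, LinearMap.mem_ker, Matrix.mulVecLin_apply, funext_iff, Pi.zero_apply,
    Matrix.mulVec, dotProduct, SimpleGraph.adjMatrix_apply, ite_mul, one_mul, zero_mul]

/-- For a vector supported on `I` the kernel equations at vertices of `I` hold automatically.
Vanishing outside `I` and the equations outside `I` are `2(|V| - |I|)` linear conditions, which
leave a space of dimension at least `2|I| - |V|`. -/
theorem two_mul_card_le_graphNullity {V : Type*} [Fintype V] {G : SimpleGraph V} {I : Finset V}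
    (hI : G.IsIndepSet (I : Set V)) : 2 * I.card ≤ graphNullity G + Fintype.card V := by
  classical
  let r : (V → ℝ) →ₗ[ℝ] ({v // v ∉ I} → ℝ) := LinearMap.funLeft ℝ ℝ Subtype.val
  let L : (V → ℝ) →ₗ[ℝ] ({v // v ∉ I} → ℝ) × ({v // v ∉ I} → ℝ) :=
    r.prod (r ∘ₗ (G.adjMatrix ℝ).mulVecLin)
  have h1 : LinearMap.ker L ≤ adjKer G := by
    intro x hx
    have hx' : L x = 0 := hx
    have ha : ∀ v, v ∉ I → x v = 0 := fun v hv => congrFun (congrArg Prod.fst hx') ⟨v, hv⟩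
    have hb : ∀ v, v ∉ I → (G.adjMatrix ℝ).mulVec x v = 0 :=
      fun v hv => congrFun (congrArg Prod.snd hx') ⟨v, hv⟩
    rw [mem_adjKer]
    intro v
    by_cases hv : v ∈ I
    · refine Finset.sum_eq_zero fun w _ => ?_
      split_ifs with h
      · exact ha w fun hw => hI hv hw h.ne h
      · rfl
    · simpa [Matrix.mulVec, dotProduct, SimpleGraph.adjMatrix_apply] using hb v hv
  have h2 := LinearMap.finrank_range_add_finrank_ker L
  have h3 := Submodule.finrank_le (LinearMap.range L)
  have h4 : Module.finrank ℝ (LinearMap.ker L) ≤ graphNullity G := Submodule.finrank_mono h1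
  have h5 := Finset.card_add_card_compl I
  have h6 : Fintype.card {v // v ∉ I} = (Iᶜ : Finset V).card := by
    rw [Fintype.card_subtype]; congr 1; ext; simp
  simp only [Module.finrank_prod, Module.finrank_fintype_fun_eq_card, h6] at h2 h3
  omega

/-- The equation at the leaf `v` forces `x u = 0` on the kernel of `G`, which therefore lies in the
kernel of `H`. The map `x ↦ (x u, (A x) u)`, with `A` the adjacency matrix of `G`, kills the former
and sends the latter onto `ℝ × ℝ`. -/
theorem graphNullity_add_two_le {V : Type*} [Fintype V] {G : SimpleGraph V} {u v : V}
    (huv : G.Adj v u) (hv : ∀ w, G.Adj v w → w = u) :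
    graphNullity G + 2 ≤ graphNullity (G.deleteIncidenceSet u) := by
  classical
  set H := G.deleteIncidenceSet u with hH
  have hHadj : ∀ a b, H.Adj a b ↔ G.Adj a b ∧ a ≠ u ∧ b ≠ u := fun a b =>
    SimpleGraph.deleteIncidenceSet_adj
  let f : (V → ℝ) →ₗ[ℝ] ℝ × ℝ := (LinearMap.proj u).prod
    ((LinearMap.proj u) ∘ₗ (G.adjMatrix ℝ).mulVecLin)
  have hf : ∀ x, f x = (x u, ∑ w, if G.Adj u w then x w else 0) := by
    intro x
    simp [f, Matrix.mulVec, dotProduct, SimpleGraph.adjMatrix_apply]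
  let φ := f.domRestrict (adjKer H)
  have hGx : ∀ x ∈ adjKer G, x u = 0 := by
    intro x hx
    have := mem_adjKer.1 hx v
    rw [Finset.sum_eq_single u] at this
    · simpa [huv] using this
    · intro w _ hw
      rw [if_neg fun h => hw (hv w h)]
    · simp
  have hle : adjKer G ≤ adjKer H := by
    intro x hx
    have hxu := hGx x hx
    rw [mem_adjKer] at hx ⊢
    intro a
    by_cases ha : a = u
    · exact Finset.sum_eq_zero fun w _ => by simp [hHadj, ha]
    · refine Eq.trans ?_ (hx a)
      refine Finset.sum_congr rfl fun w _ => ?_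
      by_cases hw : w = u
      · simp [hw, hxu]
      · simp [hHadj, ha, hw]
  have hker : (adjKer G).comap (adjKer H).subtype ≤ LinearMap.ker φ := by
    intro x hx
    have hx' : x.1 ∈ adjKer G := hx
    change f x.1 = 0
    rw [hf, hGx _ hx', mem_adjKer.1 hx' u]
    rfl
  have hsurj : LinearMap.range φ = ⊤ := by
    rw [LinearMap.range_eq_top]
    rintro ⟨p, q⟩
    -- Both `u` and `v` are isolated in `H`, so their coordinates are free in its kernel.
    have hmem : (Pi.single u p + Pi.single v q : V → ℝ) ∈ adjKer H := by
      rw [mem_adjKer]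
      refine fun a => Finset.sum_eq_zero fun w _ => ?_
      split_ifs with h
      · rw [hHadj] at h
        have hwv : w ≠ v := by
          rintro rfl
          exact h.2.1 (hv _ h.1.symm)
        simp [h.2.2, hwv]
      · rfl
    refine ⟨⟨_, hmem⟩, ?_⟩
    change f _ = _
    rw [hf]
    have h1 : u ≠ v := huv.ne'
    have h2 : ∑ w, (if G.Adj u w then (Pi.single u p + Pi.single v q : V → ℝ) w else 0) = q := by
      rw [Finset.sum_eq_single v]
      · simp [huv.symm, h1.symm]
      · intro w _ hw
        by_cases hwu : w = u
        · simp [hwu]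
        · simp [hwu, hw]
      · simp
    exact Prod.ext (by simp [h1]) h2
  have h2 := LinearMap.finrank_range_add_finrank_ker φ
  rw [hsurj, finrank_top, Module.finrank_prod, Module.finrank_self] at h2
  have h3 := Submodule.finrank_mono hker
  have h4 : Module.finrank ℝ ((adjKer G).comap (adjKer H).subtype) =
      Module.finrank ℝ (adjKer G) := (Submodule.comapSubtypeEquivOfLe hle).finrank_eq
  change Module.finrank ℝ (adjKer G) + 2 ≤ Module.finrank ℝ (adjKer H)
  omega

/-! ### Forests: matching number, independence number and nullity -/

/-- The end of a longest path is a leaf: another neighbour would either close a cycle or prolong the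
path. -/
theorem SimpleGraph.IsAcyclic.exists_leaf {V : Type*} [Fintype V] {G : SimpleGraph V}
    (hG : G.IsAcyclic) (hne : G ≠ ⊥) : ∃ v u, G.Adj v u ∧ ∀ w, G.Adj v w → w = u := by
  classical
  let P : ℕ → Prop := fun k => ∃ (u v : V) (p : G.Walk u v), p.IsPath ∧ p.length = k
  obtain ⟨a, b, hab⟩ := SimpleGraph.ne_bot_iff_exists_adj.1 hne
  have h1 : P 1 := ⟨a, b, hab.toWalk, by simpa using hab.ne, rfl⟩
  have hbd : ∀ k, P k → k ≤ Fintype.card V := by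
    rintro k ⟨u, v, p, hp, rfl⟩
    exact hp.length_lt.le
  obtain ⟨u, v, p, hp, hlen⟩ : P (Nat.findGreatest P (Fintype.card V)) :=
    Nat.findGreatest_spec (hbd 1 h1) h1
  have hmax : ∀ k, P k → k ≤ p.length := fun k hk => by
    rw [hlen]
    exact Nat.le_findGreatest (hbd k hk) hk
  have hnn : ¬ p.Nil := by
    have := hmax 1 h1
    rw [← SimpleGraph.Walk.length_eq_zero_iff]
    omega
  refine ⟨v, p.penultimate, (p.adj_penultimate hnn).symm, fun w hw => ?_⟩
  by_cases hs : w ∈ p.support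
  · exact hG.eq_penultimate_of_adj_end hp hw hs
  · have := hmax _ ⟨u, w, p.concat hw, hp.concat hs hw, rfl⟩
    simp at this

/-- Induction on the number of edges: isolate the neighbour `u` of a leaf `v`, then add the edge
`vu` to `M` and drop `u` from `I`. The vertex set stays fixed, so isolated vertices count in `I`. -/
theorem SimpleGraph.IsAcyclic.exists_matching_indepSet {V : Type*} [Fintype V]
    {G : SimpleGraph V} (hG : G.IsAcyclic) : ∃ (M : Finset (Sym2 V)) (I : Finset V),
      IsEdgeMatching G M ∧ G.IsIndepSet (I : Set V) ∧ M.card + I.card = Fintype.card V ∧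
      graphNullity G + 2 * M.card ≤ Fintype.card V := by
  classical
  induction hk : G.edgeSet.ncard using Nat.strong_induction_on generalizing G with
  | _ k ih =>
  by_cases hne : G = ⊥
  · refine ⟨∅, Finset.univ, ⟨by simp, by simp⟩, ?_, by simp, ?_⟩
    · intro a _ b _ _
      simp [hne]
    · have := Submodule.finrank_le (adjKer G)
      simp only [Module.finrank_fintype_fun_eq_card] at this
      change Module.finrank ℝ (adjKer G) + _ ≤ _
      simpa using this
  obtain ⟨v, u, huv, hv⟩ := hG.exists_leaf hne
  set H := G.deleteIncidenceSet u with hH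
  have hHadj : ∀ a b, H.Adj a b ↔ G.Adj a b ∧ a ≠ u ∧ b ≠ u := fun a b =>
    SimpleGraph.deleteIncidenceSet_adj
  have hle : H ≤ G := fun a b h => ((hHadj a b).1 h).1
  have hlt : H.edgeSet.ncard < k := by
    rw [← hk]
    refine Set.ncard_lt_ncard (SimpleGraph.edgeSet_strict_mono (lt_of_le_of_ne hle ?_))
    intro h
    have := (hHadj v u).1 (h ▸ huv)
    exact this.2.2 rfl
  obtain ⟨M, I, hM, hI, hc, hnull⟩ := ih _ hlt (hG.anti hle) rfl
  have hMu : ∀ e ∈ M, u ∉ e ∧ v ∉ e := by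
    intro e he
    have he' := hM.1 he
    induction e with
    | _ a b =>
      have hab : G.Adj a b ∧ a ≠ u ∧ b ≠ u := (hHadj a b).1 he'
      simp only [Sym2.mem_iff, not_or]
      refine ⟨⟨hab.2.1.symm, hab.2.2.symm⟩, ?_, ?_⟩
      · rintro rfl
        exact hab.2.2 (hv _ hab.1)
      · rintro rfl
        exact hab.2.1 (hv _ hab.1.symm)
  -- `u` is isolated in `H`; if it were missing, `I ∪ {u}` would be independent and violate `|M| +
  -- |I| ≤ |V|`.
  have huI : u ∈ I := by
    by_contra hu
    have : H.IsIndepSet ((insert u I : Finset V) : Set V) := by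
      rw [Finset.coe_insert]
      refine hI.insert fun b _ _ => ?_
      simp [hHadj]
    have := hM.ncard_add_card_le this
    rw [Set.ncard_coe_finset, Finset.card_insert_of_notMem hu] at this
    omega
  have hnew : s(v, u) ∉ M := fun h => (hMu _ h).1 (by simp)
  refine ⟨insert s(v, u) M, I.erase u, ⟨?_, ?_⟩, ?_, ?_, ?_⟩
  · rw [Finset.coe_insert, Set.insert_subset_iff]
    exact ⟨huv, hM.1.trans (SimpleGraph.edgeSet_mono hle)⟩
  · intro e he e' he' w hw hw'
    simp only [Finset.coe_insert, Set.mem_insert_iff, Finset.mem_coe] at he he'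
    rcases he with rfl | he <;> rcases he' with rfl | he'
    · rfl
    · rcases Sym2.mem_iff.1 hw with rfl | rfl
      · exact absurd hw' (hMu _ he').2
      · exact absurd hw' (hMu _ he').1
    · rcases Sym2.mem_iff.1 hw' with rfl | rfl
      · exact absurd hw (hMu _ he).2
      · exact absurd hw (hMu _ he).1
    · exact hM.2 e he e' he' w hw hw'
  · intro a ha b hb hab h
    simp only [Finset.coe_erase, Set.mem_sdiff, Finset.mem_coe, Set.mem_singleton_iff] at ha hb
    exact hI ha.1 hb.1 hab ((hHadj a b).2 ⟨h, ha.2, hb.2⟩)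
  · rw [Finset.card_insert_of_notMem hnew, Finset.card_erase_of_mem huI]
    have := Finset.card_pos.2 ⟨u, huI⟩
    omega
  · rw [Finset.card_insert_of_notMem hnew]
    have := graphNullity_add_two_le huv hv
    rw [← hH] at this
    omega

theorem SimpleGraph.IsAcyclic.matchingNumber_add_indepNum {V : Type*} [Fintype V]
    {G : SimpleGraph V} (hG : G.IsAcyclic) :
    matchingNumber G + G.indepNum = Fintype.card V := by
  obtain ⟨M, I, hM, hI, hc, -⟩ := hG.exists_matching_indepSet
  obtain ⟨J, hJ⟩ := G.exists_isNIndepSet_indepNum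
  have h1 := matchingNumber_add_card_le hJ.1
  have h2 := hM.ncard_le
  have h3 := hI.card_le_indepNum
  rw [Set.ncard_coe_finset] at h2
  rw [hJ.2] at h1
  omega

theorem SimpleGraph.IsAcyclic.graphNullity_add_card {V : Type*} [Fintype V]
    {G : SimpleGraph V} (hG : G.IsAcyclic) :
    graphNullity G + Fintype.card V = 2 * G.indepNum := by
  obtain ⟨M, I, hM, hI, hc, hn⟩ := hG.exists_matching_indepSet
  obtain ⟨J, hJ⟩ := G.exists_isNIndepSet_indepNum
  have h1 := matchingNumber_add_card_le hJ.1
  have h2 := hM.ncard_le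
  have h3 := hI.card_le_indepNum
  have h4 := two_mul_card_le_graphNullity hJ.1
  rw [Set.ncard_coe_finset] at h2
  rw [hJ.2] at h1 h4
  omega

/-! ### Degree sums and the annihilation number -/

open Classical in
-- All edges at `I` end in the complement, so the degree sum over `I` is at most that over the
-- complement.
theorem SimpleGraph.IsIndepSet.two_mul_sum_degree_le {V : Type*} [Fintype V] {G : SimpleGraph V}
    {I : Finset V} (hI : G.IsIndepSet (I : Set V)) :
    2 * ∑ v ∈ I, G.degree v ≤ ∑ v, G.degree v := by
  have hdeg : ∀ v, G.degree v = ∑ w, if G.Adj v w then 1 else 0 := fun v => by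
    rw [← SimpleGraph.card_neighborFinset_eq_degree, SimpleGraph.neighborFinset_eq_filter,
      Finset.card_filter]
  have h1 : ∑ v ∈ I, G.degree v ≤ ∑ w ∈ Iᶜ, G.degree w := by
    calc ∑ v ∈ I, G.degree v = ∑ v ∈ I, ∑ w ∈ Iᶜ, if G.Adj v w then 1 else 0 := by
          refine Finset.sum_congr rfl fun v hv => ?_
          rw [hdeg]
          refine (Finset.sum_subset (Finset.subset_univ _) fun w _ hw => ?_).symm
          rw [Finset.mem_compl, not_not] at hw
          exact if_neg fun h => hI hv hw h.ne h
      _ = ∑ w ∈ Iᶜ, ∑ v ∈ I, if G.Adj v w then 1 else 0 := Finset.sum_comm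
      _ ≤ ∑ w ∈ Iᶜ, G.degree w := by
          refine Finset.sum_le_sum fun w _ => ?_
          rw [hdeg]
          simp only [G.adj_comm _ w]
          exact Finset.sum_le_sum_of_subset (Finset.subset_univ _)
  have h2 := Finset.sum_add_sum_compl I fun v => G.degree v
  omega

theorem Monotone.sum_filter_lt_card_le {n : ℕ} {s : Fin n → ℕ} (hs : Monotone s)
    (J : Finset (Fin n)) : ∑ i with i.val < J.card, s i ≤ ∑ i ∈ J, s i := by
  have hJ : J.card ≤ n := by simpa using J.card_le_univ
  have h1 : (Finset.univ.filter fun i : Fin n => i.val < J.card) =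
      Finset.univ.map (Fin.castLEEmb hJ) := by
    ext i
    simp only [Finset.mem_filter, Finset.mem_univ, true_and, Finset.mem_map, Fin.castLEEmb_apply]
    exact ⟨fun h => ⟨⟨i, h⟩, rfl⟩, by rintro ⟨a, rfl⟩; exact a.2⟩
  have h2 : J = Finset.univ.map (J.orderEmbOfFin rfl).toEmbedding := by simp
  rw [h1, Finset.sum_map]
  conv_rhs => rw [h2, Finset.sum_map]
  refine Finset.sum_le_sum fun i _ => hs ?_
  have hmono : StrictMono fun i : Fin J.card => ((J.orderEmbOfFin rfl i : Fin n) : ℕ) :=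
    fun a b h => (J.orderEmbOfFin rfl).strictMono h
  -- The element of rank `k` in `J`, counted from `0`, has index at least `k`; monotonicity of `s`
  -- then compares the sums termwise.
  have key : ∀ k (hk : k < J.card), k ≤ (J.orderEmbOfFin rfl ⟨k, hk⟩ : Fin n).val := by
    intro k
    induction k with
    | zero => simp
    | succ k ih =>
      intro hk
      have := ih (by omega)
      have h3 : (J.orderEmbOfFin rfl ⟨k, by omega⟩ : Fin n).val <
          (J.orderEmbOfFin rfl ⟨k + 1, hk⟩ : Fin n).val := hmono (by simp [Fin.lt_def])
      omega
  exact key i i.2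

theorem exists_perm_of_map_univ_eq {ι α : Type*} [Fintype ι] {f g : ι → α}
    (h : Multiset.map f Finset.univ.val = Multiset.map g Finset.univ.val) :
    ∃ σ : Equiv.Perm ι, ∀ v, g (σ v) = f v := by
  classical
  have key : ∀ c, Nonempty ({a // f a = c} ≃ {a // g a = c}) := fun c => by
    rw [← Fintype.card_eq, Fintype.card_subtype, Fintype.card_subtype]
    have := congrArg (Multiset.count c) h
    rw [Multiset.count_map, Multiset.count_map] at this
    simpa [Finset.card, eq_comm] using this
  exact ⟨Equiv.ofFiberEquiv fun c => (key c).some, fun v => Equiv.ofFiberEquiv_map _ v⟩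

theorem HasDegreeSequence.indepNum_le {n : ℕ} {s : Fin n → ℕ} (hs : Monotone s)
    {G : SimpleGraph (Fin n)} (hG : HasDegreeSequence G s) :
    G.indepNum ≤ annihilationNumber s := by
  classical
  obtain ⟨I, hI⟩ := G.exists_isNIndepSet_indepNum
  obtain ⟨σ, hσ⟩ := exists_perm_of_map_univ_eq hG
  rw [← hI.2]
  refine Nat.le_findGreatest (by simpa using I.card_le_univ) ?_
  have h1 := hI.1.two_mul_sum_degree_le
  have h2 := hs.sum_filter_lt_card_le (I.map σ.toEmbedding)
  rw [Finset.card_map, Finset.sum_map] at h2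
  have h3 : ∀ v, G.degree v = s (σ v) := fun v => by
    rw [hσ v]
  simp only [h3] at h1
  rw [Equiv.sum_comp σ s] at h1
  simp only [Equiv.coe_toEmbedding] at h2
  omega

/-! ### Closed form of the run of the algorithm -/

namespace MaxNullity

variable {n : ℕ} {s : Fin n → ℕ}

theorem entry_of_mem {j : ℕ} (h : 1 ≤ j ∧ j ≤ n) : entry s j = s ⟨j - 1, by omega⟩ := dif_pos h

theorem entry_succ (i : Fin n) : entry s (i.val + 1) = s i := by
  rw [entry_of_mem ⟨by omega, i.2⟩]
  rfl

/-- The sum of `d_j - 1` over `1 ≤ j ≤ p`. -/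
def excess (s : Fin n → ℕ) (p : ℕ) : ℕ :=
  ∑ j ∈ Finset.range p, (entry s (j + 1) - 1)

theorem excess_succ (s : Fin n → ℕ) (p : ℕ) :
    excess s (p + 1) = excess s p + (entry s (p + 1) - 1) :=
  Finset.sum_range_succ _ _

theorem excess_mono (s : Fin n → ℕ) : Monotone (excess s) :=
  monotone_nat_of_le_succ fun p => by rw [excess_succ]; omega

theorem lt_numLeaves_iff (hs : Monotone s) (hpos : ∀ i, 0 < s i) (i : Fin n) :
    i.val < numLeaves s ↔ s i = 1 := by
  constructor
  · intro h
    by_contra h1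
    have : (Finset.univ.filter fun j => s j = 1) ⊆ Finset.Iio i := by
      intro j hj
      rw [Finset.mem_Iio]
      by_contra hij
      have h2 := hs (not_lt.1 hij)
      have h3 := hpos i
      have h4 := (Finset.mem_filter.1 hj).2
      omega
    have := Finset.card_le_card this
    rw [Fin.card_Iio] at this
    exact absurd h (not_lt.2 this)
  · intro h
    have : Finset.Iic i ⊆ (Finset.univ.filter fun j => s j = 1) := by
      intro j hj
      have h2 := hs (Finset.mem_Iic.1 hj)
      have h3 := hpos j
      simp only [Finset.mem_filter, Finset.mem_univ, true_and]
      omega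
    have := Finset.card_le_card this
    rw [Fin.card_Iic] at this
    exact this

theorem numLeaves_le (s : Fin n → ℕ) : numLeaves s ≤ n :=
  (Finset.card_le_univ _).trans_eq (Fintype.card_fin n)

theorem entry_eq_one (hs : Monotone s) (hpos : ∀ i, 0 < s i) {p : ℕ} (h1 : 1 ≤ p)
    (h2 : p ≤ numLeaves s) : entry s p = 1 := by
  have := numLeaves_le s
  rw [entry_of_mem ⟨h1, by omega⟩, ← lt_numLeaves_iff hs hpos]
  change p - 1 < _
  omega

theorem two_le_entry (hs : Monotone s) (hpos : ∀ i, 0 < s i) {p : ℕ}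
    (h1 : numLeaves s < p) (h2 : p ≤ n) : 2 ≤ entry s p := by
  rw [entry_of_mem ⟨by omega, h2⟩]
  have h3 := hpos ⟨p - 1, by omega⟩
  have h4 := (lt_numLeaves_iff hs hpos ⟨p - 1, by omega⟩).not.1 (by change ¬ (p - 1 < _); omega)
  omega

theorem excess_numLeaves (hs : Monotone s) (hpos : ∀ i, 0 < s i) : excess s (numLeaves s) = 0 := by
  refine Finset.sum_eq_zero fun j hj => ?_
  rw [entry_eq_one hs hpos (by omega) (Finset.mem_range.1 hj), Nat.sub_self]

theorem excess_lt (hs : Monotone s) (hpos : ∀ i, 0 < s i) {p q : ℕ} (h1 : numLeaves s ≤ p)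
    (h2 : p < q) (h3 : q ≤ n) : excess s p < excess s q := by
  have h4 := excess_succ s p
  have h5 := two_le_entry hs hpos (p := p + 1) (by omega) (by omega)
  have h6 := excess_mono s (show p + 1 ≤ q by omega)
  omega

theorem sum_filter_lt_eq {a : ℕ} (ha : a ≤ n) (hpos : ∀ i, 0 < s i) :
    ∑ i with i.val < a, s i = a + excess s a := by
  have h1 : ∑ i with i.val < a, s i = ∑ j ∈ Finset.range a, entry s (j + 1) := by
    refine Finset.sum_bij (fun i _ => i.val) ?_ ?_ ?_ ?_
    · intro i hi
      simpa using hi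
    · intro i _ j _ h
      exact Fin.ext h
    · intro j hj
      have := Finset.mem_range.1 hj
      exact ⟨⟨j, by omega⟩, by simpa using this, rfl⟩
    · intro i _
      rw [entry_succ]
  rw [h1, excess]
  have h2 : ∀ j ∈ Finset.range a, entry s (j + 1) = 1 + (entry s (j + 1) - 1) := by
    intro j hj
    have := Finset.mem_range.1 hj
    have h3 := entry_succ (s := s) ⟨j, by omega⟩
    have h4 := hpos ⟨j, by omega⟩
    change entry s (j + 1) = _ at h3
    omega
  rw [Finset.sum_congr rfl h2, Finset.sum_add_distrib]
  simp

/-- The relation "`p` is the parent of `c`" in the output of the algorithm after `i` vertices have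
been put into `V_K` and the vertices `v_n, …, v_b` have been processed. -/
def IsParent (s : Fin n → ℕ) (i b p c : ℕ) : Prop :=
  (∃ r < i, p = n - 1 - excess s (n - excess s (numLeaves s + r) - 1) ∧
    n ≤ c + excess s (numLeaves s + r + 1) ∧ c + excess s (numLeaves s + r) < n) ∨
  (b ≤ p ∧ p ≤ n ∧ 1 ≤ c ∧ c + excess s (p - 1) < n ∧ (p = n ∨ n ≤ c + excess s p))

/-- The invariant of the algorithm: `i` vertices have been put into `V_K`, the vertices
`v_n, …, v_b` have been processed. -/
structure Inv (s : Fin n → ℕ) (σ : State) (i b : ℕ) : Prop where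
  k_eq : σ.k + excess s (b - 1) + 1 = n
  t_eq : σ.t + excess s (b - 1) = n + excess s (numLeaves s + i)
  edges : ∀ p c, (p, c) ∈ σ.edges ↔ IsParent s i b p c
  VK_eq : σ.VK = (List.range i).map fun r =>
    n - 1 - excess s (n - excess s (numLeaves s + r) - 1)
  lt_b : numLeaves s + i < b
  b_le : b ≤ n
  le_eta : ∀ r < i, b + excess s (numLeaves s + r) ≤ n

/-- By `t_eq`, `t = n` means `excess s (b - 1) = excess s (l + i)`, where `l = numLeaves s`, and
`excess` is strictly increasing from `l` on. The algorithm stops exactly when the degrees used from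
below meet those used from above. -/
theorem Inv.t_eq_iff (hs : Monotone s) (hpos : ∀ i, 0 < s i) {σ : State} {i b : ℕ}
    (h : Inv s σ i b) : σ.t = n ↔ b = numLeaves s + i + 1 := by
  have h1 := h.t_eq
  have h2 := h.lt_b
  have h3 := h.b_le
  constructor
  · intro h4
    by_contra h5
    have := excess_lt hs hpos (p := numLeaves s + i) (q := b - 1) (by omega) (by omega) (by omega)
    omega
  · rintro rfl
    simp only [Nat.add_sub_cancel] at h1
    omega

theorem Inv.t_le (s : Fin n → ℕ) {σ : State} {i b : ℕ}
    (h : Inv s σ i b) : σ.t ≤ n := by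
  have h1 := h.t_eq
  have h2 := h.lt_b
  have := excess_mono s (show numLeaves s + i ≤ b - 1 by omega)
  omega

theorem Inv.innerStep (hs : Monotone s) (hpos : ∀ i, 0 < s i) {σ : State} {i b : ℕ}
    (h : Inv s σ i b) (ht : σ.t ≠ n) : Inv s (innerStep s σ (b - 1)) i (b - 1) := by
  have h0 := (h.t_eq_iff hs hpos).not.1 ht
  have h1 := h.lt_b
  have h2 := h.b_le
  obtain ⟨c, rfl⟩ : ∃ c, b = c + 2 := ⟨b - 2, by omega⟩
  have h3 := excess_succ s c
  have h4 := two_le_entry hs hpos (p := c + 1) (by omega) (by omega)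
  have h5 := h.k_eq
  have h6 := h.t_eq
  simp only [show c + 2 - 1 = c + 1 by omega] at h5 h6 ⊢
  rw [MaxNullity.innerStep, if_neg ht]
  refine ⟨?_, ?_, ?_, h.VK_eq, by omega, by omega, fun r hr => ?_⟩
  · simp only [Nat.add_sub_cancel]
    omega
  · simp only [Nat.add_sub_cancel]
    omega
  · intro p q
    simp only [List.mem_append, h.edges, List.mem_map, List.mem_range, Prod.mk.injEq, IsParent,
      or_assoc]
    refine or_congr Iff.rfl ⟨?_, ?_⟩
    · rintro (⟨h7, h8, h9, h10, h11⟩ | ⟨a, ha, rfl, rfl⟩)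
      · exact ⟨by omega, h8, h9, h10, h11⟩
      · simp only [Nat.add_sub_cancel]
        omega
    · rintro ⟨h7, h8, h9, h10, h11⟩
      by_cases h12 : p = c + 1
      · subst h12
        simp only [Nat.add_sub_cancel] at h10
        exact Or.inr ⟨q - (σ.k + 1), by omega, rfl, by omega⟩
      · exact Or.inl ⟨by omega, h8, h9, h10, h11⟩
  · have := h.le_eta r hr
    omega

theorem innerStep_of_eq {σ : State} (ht : σ.t = n) (j : ℕ) : innerStep s σ j = σ := if_pos ht

theorem innerStep_h (σ : State) (j : ℕ) : (innerStep s σ j).h = σ.h := by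
  unfold innerStep; split_ifs <;> rfl

theorem innerStep_i (σ : State) (j : ℕ) : (innerStep s σ j).i = σ.i := by
  unfold innerStep; split_ifs <;> rfl

/-- The inner loop may be cut short by `t = n`; only otherwise does the threshold drop by the full
`r`. -/
theorem Inv.foldl (hs : Monotone s) (hpos : ∀ i, 0 < s i) {σ : State} {i b : ℕ}
    (h : Inv s σ i b) (r : ℕ) :
    let τ := ((List.range r).map fun a => b - 1 - a).foldl (MaxNullity.innerStep s) σ
    τ.h = σ.h ∧ τ.i = σ.i ∧ ∃ b', b' ≤ b ∧ b ≤ b' + r ∧ Inv s τ i b' ∧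
      (τ.t ≠ n → b' + r = b) := by
  induction r with
  | zero => exact ⟨rfl, rfl, b, le_rfl, by omega, h, fun _ => rfl⟩
  | succ r ih =>
    obtain ⟨h1, h2, b', h3, h4, h5, h6⟩ := ih
    simp only [List.range_succ, List.map_append, List.foldl_append, List.map_cons, List.map_nil,
      List.foldl_cons, List.foldl_nil]
    set τ := ((List.range r).map fun a => b - 1 - a).foldl (MaxNullity.innerStep s) σ
    refine ⟨(innerStep_h _ _).trans h1, (innerStep_i _ _).trans h2, ?_⟩
    by_cases ht : τ.t = n
    · rw [innerStep_of_eq ht]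
      exact ⟨b', h3, by omega, h5, fun h => absurd ht h⟩
    · have h7 := h6 ht
      have h8 := h5.innerStep hs hpos ht
      rw [show b - 1 - r = b' - 1 by omega]
      have := h5.lt_b
      exact ⟨b' - 1, by omega, by omega, h8, fun _ => by omega⟩

/-- At the beginning of a pass the processed threshold `b` equals `h`, which identifies `v_k` with
the closed form of the hub. A complete pass restores this equality; a pass that reaches `t = n`
leaves only an inequality, which later becomes `cross`. -/
theorem Inv.outerStep (hs : Monotone s) (hpos : ∀ i, 0 < s i) (hn : excess s n + 2 = n)
    {σ : State} {i b : ℕ} (h : Inv s σ i b) (ht : σ.t ≠ n) (hi : σ.i = i + 1)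
    (hh : σ.h = b) (hb : b + excess s (numLeaves s + i) = n) :
    let τ := outerStep s σ
    ∃ b', Inv s τ (i + 1) b' ∧ τ.i = i + 2 ∧ n ≤ b' + excess s (numLeaves s + (i + 1)) ∧
      (τ.t ≠ n → τ.h = b' ∧ b' + excess s (numLeaves s + (i + 1)) = n) := by
  have h0 := (h.t_eq_iff hs hpos).not.1 ht
  have h1 := h.lt_b
  have h2 := h.b_le
  have h3 := excess_succ s (numLeaves s + i)
  have h4 := two_le_entry hs hpos (p := numLeaves s + i + 1) (by omega) (by omega)
  have h5 := h.k_eq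
  have h6 := h.t_eq
  have h7 := h.t_le
  have hm := excess_mono s (show b - 1 ≤ n by omega)
  have hm' := excess_mono s (show numLeaves s + i + 1 ≤ n by omega)
  set c := entry s (numLeaves s + i + 1) with hc
  set σ₁ : State := ⟨σ.edges ++ ((List.range (c - 1)).map fun r => b - 1 - r).map
    fun j => (σ.k, j), σ.t + (c - 1), σ.k, i + 1, b, σ.VK ++ [σ.k]⟩ with hσ₁
  have hτ : MaxNullity.outerStep s σ = { ((List.range (c - 1)).map fun r => b - 1 - r).foldl
      (MaxNullity.innerStep s) σ₁ with h := b - (c - 1), i := i + 2 } := by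
    simp only [MaxNullity.outerStep, if_pos (lt_of_le_of_ne h7 ht), hi, hh, downFrom,
      ← Nat.add_assoc, ← hc, hσ₁]
  rw [hτ]
  have hk : σ.k = n - 1 - excess s (n - excess s (numLeaves s + i) - 1) := by
    rw [show n - excess s (numLeaves s + i) = b by omega]
    omega
  have hI : Inv s σ₁ (i + 1) b := by
    refine ⟨h5, ?_, ?_, ?_, by omega, h2, fun r hr => ?_⟩
    · change σ.t + (c - 1) + _ = _
      rw [← Nat.add_assoc]
      omega
    · intro p q
      simp only [hσ₁, List.mem_append, h.edges, List.mem_map, List.mem_range, Prod.mk.injEq,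
        IsParent, exists_exists_and_eq_and]
      constructor
      · rintro ((⟨r, hr, h8⟩ | h8) | ⟨a, ha, rfl, rfl⟩)
        · exact Or.inl ⟨r, by omega, h8⟩
        · exact Or.inr h8
        · exact Or.inl ⟨i, by omega, hk, by omega, by omega⟩
      · rintro (⟨r, hr, h8⟩ | h8)
        · by_cases hri : r = i
          · subst hri
            exact Or.inr ⟨b - 1 - q, by omega, by omega, by omega⟩
          · exact Or.inl (Or.inl ⟨r, by omega, h8⟩)
        · exact Or.inl (Or.inr h8)
    · change σ.VK ++ [σ.k] = _
      rw [List.range_succ, List.map_append, h.VK_eq, hk]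
      rfl
    · by_cases hri : r = i
      · subst hri
        omega
      · exact h.le_eta r (by omega)
  obtain ⟨h8, h9, b', h10, h11, h12, h13⟩ := hI.foldl hs hpos (c - 1)
  refine ⟨b', ⟨h12.k_eq, h12.t_eq, h12.edges, h12.VK_eq, h12.lt_b, h12.b_le, h12.le_eta⟩, ?_, ?_,
    ?_⟩
  · rfl
  · rw [← Nat.add_assoc]
    omega
  · intro ht'
    have := h13 ht'
    rw [← Nat.add_assoc]
    refine ⟨?_, by omega⟩
    change b - (c - 1) = b'
    omega

theorem outerStep_of_eq {σ : State} (ht : σ.t = n) : outerStep s σ = σ :=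
  if_neg (by omega)

/-- `v_n` has no parent, so it has `d_n` children instead of `d_n - 1`. The additional child `v_1`
is the reason for the alternative `p = n` in `IsParent`. -/
theorem inv_start (hs : Monotone s) (hpos : ∀ i, 0 < s i) (hn : excess s n + 2 = n)
    (hn3 : 3 ≤ n) : Inv s (start s) 0 n := by
  have h0 := excess_numLeaves hs hpos
  have h1 := numLeaves_le s
  have h2 : numLeaves s ≠ n := fun h => by
    rw [h] at h0
    omega
  have h3 := excess_succ s (n - 1)
  have h4 := two_le_entry hs hpos (p := n) (by omega) le_rfl
  rw [show n - 1 + 1 = n by omega] at h3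
  refine ⟨?_, ?_, ?_, rfl, by omega, le_rfl, fun r hr => by omega⟩
  · change entry s n + _ + 1 = n
    omega
  · change entry s n + 1 + _ = n + _
    simp only [Nat.add_zero, h0]
    omega
  · intro p c
    simp only [start, List.mem_map, List.mem_range, Prod.mk.injEq, IsParent]
    constructor
    · rintro ⟨a, ha, rfl, rfl⟩
      exact Or.inr ⟨le_rfl, le_rfl, by omega, by omega, Or.inl rfl⟩
    · rintro (⟨r, hr, -⟩ | ⟨h5, h6, h7, h8, -⟩)
      · omega
      · obtain rfl : p = n := by omega
        exact ⟨c - 1, by omega, rfl, by omega⟩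

/-- When the algorithm stops, `m` vertices have been put into `V_K` and the vertices
`v_n, …, v_{l+m+1}` have been processed. -/
theorem exists_inv_run (hs : Monotone s) (hpos : ∀ i, 0 < s i) (hn : excess s n + 2 = n)
    (hn3 : 3 ≤ n) : ∃ m, Inv s (run s) m (numLeaves s + m + 1) ∧
      n ≤ numLeaves s + m + 1 + excess s (numLeaves s + m) := by
  have key : ∀ r, ∃ i b, Inv s ((outerStep s)^[r] (start s)) i b ∧
      n ≤ b + excess s (numLeaves s + i) ∧
      (((outerStep s)^[r] (start s)).t ≠ n → i = r ∧ ((outerStep s)^[r] (start s)).i = i + 1 ∧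
        ((outerStep s)^[r] (start s)).h = b ∧ b + excess s (numLeaves s + i) = n) := by
    intro r
    induction r with
    | zero =>
      refine ⟨0, n, inv_start hs hpos hn hn3, by omega, fun _ => ⟨rfl, rfl, rfl, ?_⟩⟩
      rw [Nat.add_zero, excess_numLeaves hs hpos]
      rfl
    | succ r ih =>
      obtain ⟨i, b, h1, h2, h3⟩ := ih
      rw [Function.iterate_succ_apply']
      set σ := (outerStep s)^[r] (start s)
      by_cases ht : σ.t = n
      · rw [outerStep_of_eq ht]
        exact ⟨i, b, h1, h2, fun h => absurd ht h⟩
      · obtain ⟨rfl, h4, h5, h6⟩ := h3 ht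
        obtain ⟨b', h7, h8, h9, h10⟩ := h1.outerStep hs hpos hn ht h4 h5 h6
        exact ⟨i + 1, b', h7, h9, fun h => ⟨rfl, h8, h10 h⟩⟩
  obtain ⟨i, b, h1, h2, h3⟩ := key n
  -- Otherwise all `n` passes were effective and `i = n`, against `numLeaves s + i < b ≤ n`.
  have ht : ((outerStep s)^[n] (start s)).t = n := by
    by_contra ht
    obtain ⟨h4, -⟩ := h3 ht
    have := h1.lt_b
    have := h1.b_le
    omega
  have h4 := (h1.t_eq_iff hs hpos).1 ht
  subst h4
  exact ⟨i, h1, h2⟩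

end MaxNullity

/-! ### Arithmetic, adjacency and connectedness of the output -/

namespace MaxNullity

variable {n : ℕ} {s : Fin n → ℕ} {m : ℕ}

/-- The value of `h` after `i` passes of the outer loop. -/
def eta (s : Fin n → ℕ) (i : ℕ) : ℕ := n - excess s (numLeaves s + i)

/-- The value of `k` after `v_n, …, v_j` have been processed. -/
def kap (s : Fin n → ℕ) (j : ℕ) : ℕ := n - 1 - excess s (j - 1)

/-- The index of the vertex put into `V_K` after `i` passes of the outer loop. -/
def hub (s : Fin n → ℕ) (i : ℕ) : ℕ := kap s (eta s i)

/-- The smallest index that is processed when `m` vertices have been put into `V_K`. -/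
def low (s : Fin n → ℕ) (m : ℕ) : ℕ := numLeaves s + m + 1

/-- The final state of the algorithm, when `m` vertices have been put into `V_K`. -/
structure Final (s : Fin n → ℕ) (m : ℕ) : Prop where
  mono : Monotone s
  pos : ∀ i, 0 < s i
  sum_eq : ∑ i, s i + 2 = 2 * n
  excess_eq : excess s n + 2 = n
  three_le : 3 ≤ n
  inv : Inv s (run s) m (low s m)
  cross : n ≤ low s m + excess s (numLeaves s + m)

namespace Final

theorem low_le (h : Final s m) : low s m ≤ n := h.inv.b_le

theorem leaves_lt_low (_ : Final s m) : numLeaves s + m + 1 = low s m := rfl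

theorem eta_add (h : Final s m) {i : ℕ} (hi : i ≤ m) :
    eta s i + excess s (numLeaves s + i) = n := by
  have h1 := h.low_le
  have h2 := h.leaves_lt_low
  have h3 := excess_mono s (show numLeaves s + i ≤ n by omega)
  have h4 := h.excess_eq
  unfold eta
  omega

theorem kap_add (h : Final s m) {j : ℕ} (hj : j ≤ n + 1) :
    kap s j + excess s (j - 1) + 1 = n := by
  have h3 := excess_mono s (show j - 1 ≤ n by omega)
  have h4 := h.excess_eq
  unfold kap
  omega

theorem one_le_kap (h : Final s m) {j : ℕ} (hj : j ≤ n + 1) : 1 ≤ kap s j := by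
  have h3 := excess_mono s (show j - 1 ≤ n by omega)
  have h4 := h.excess_eq
  have := h.kap_add hj
  omega

theorem eta_zero (h : Final s m) : eta s 0 = n := by
  have := h.eta_add (Nat.zero_le _)
  rw [Nat.add_zero, excess_numLeaves h.mono h.pos] at this
  omega

theorem eta_lt (h : Final s m) {i j : ℕ} (hij : i < j) (hj : j ≤ m) : eta s j < eta s i := by
  have h1 := h.low_le
  have h2 := h.leaves_lt_low
  have h3 := h.eta_add hj
  have h4 := h.eta_add (show i ≤ m by omega)
  have h5 := excess_lt h.mono h.pos (show numLeaves s ≤ numLeaves s + i by omega)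
    (show numLeaves s + i < numLeaves s + j by omega) (by omega)
  omega

theorem eta_le (h : Final s m) {i j : ℕ} (hij : i ≤ j) (hj : j ≤ m) : eta s j ≤ eta s i := by
  rcases hij.eq_or_lt with rfl | hij
  · rfl
  · exact (h.eta_lt hij hj).le

theorem eta_le_n (s : Fin n → ℕ) (i : ℕ) : eta s i ≤ n := Nat.sub_le _ _

theorem low_le_eta (h : Final s m) {i : ℕ} (hi : i < m) : low s m ≤ eta s i := by
  have h1 := h.inv.le_eta i hi
  have h2 := h.eta_add hi.le
  omega

theorem eta_le_low (h : Final s m) : eta s m ≤ low s m := by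
  have h1 := h.cross
  have h2 := h.eta_add le_rfl
  omega

theorem kap_low (h : Final s m) : kap s (low s m) + 1 = eta s m := by
  have h1 := h.kap_add (show low s m ≤ n + 1 by have := h.low_le; omega)
  have h2 := h.eta_add le_rfl
  have h3 : low s m - 1 = numLeaves s + m := rfl
  rw [h3] at h1
  omega

theorem kap_lt (h : Final s m) {i j : ℕ} (hi : low s m ≤ i) (hij : i < j) (hj : j ≤ n + 1) :
    kap s j < kap s i := by
  have h1 := h.leaves_lt_low
  have h2 := h.kap_add hj
  have h3 := h.kap_add (show i ≤ n + 1 by omega)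
  have h4 := excess_lt h.mono h.pos (show numLeaves s ≤ i - 1 by omega)
    (show i - 1 < j - 1 by omega) (by omega)
  omega

theorem kap_le (h : Final s m) {i j : ℕ} (hi : low s m ≤ i) (hij : i ≤ j) (hj : j ≤ n + 1) :
    kap s j ≤ kap s i := by
  rcases hij.eq_or_lt with rfl | hij
  · rfl
  · exact (h.kap_lt hi hij hj).le

theorem kap_lt_eta (h : Final s m) {j : ℕ} (hj : low s m ≤ j) (hjn : j ≤ n + 1) :
    kap s j < eta s m := by
  have h1 := h.kap_le le_rfl hj hjn
  have h2 := h.kap_low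
  omega

theorem hub_lt_eta (h : Final s m) {r : ℕ} (hr : r < m) : hub s r < eta s m :=
  h.kap_lt_eta (h.low_le_eta hr) (by have := eta_le_n s r; omega)

theorem one_le_hub (h : Final s m) (r : ℕ) : 1 ≤ hub s r :=
  h.one_le_kap (by have := eta_le_n s r; omega)

theorem hub_lt_hub (h : Final s m) {i j : ℕ} (hij : i < j) (hj : j < m) : hub s i < hub s j :=
  h.kap_lt (h.low_le_eta hj) (h.eta_lt hij hj.le) (by have := eta_le_n s i; omega)

theorem hub_inj (h : Final s m) {i j : ℕ} (hi : i < m) (hj : j < m) (hij : hub s i = hub s j) :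
    i = j := by
  rcases lt_trichotomy i j with h1 | h1 | h1
  · have := h.hub_lt_hub h1 hj
    omega
  · exact h1
  · have := h.hub_lt_hub h1 hi
    omega

theorem kap_sub (h : Final s m) {j : ℕ} (hj : low s m ≤ j) (hjn : j ≤ n) :
    kap s j = kap s (j + 1) + (entry s j - 1) := by
  have h0 := h.leaves_lt_low
  have h1 := h.kap_add (show j ≤ n + 1 by omega)
  have h2 := h.kap_add (show j + 1 ≤ n + 1 by omega)
  have h3 := excess_succ s (j - 1)
  rw [show j - 1 + 1 = j by omega] at h3
  rw [Nat.add_sub_cancel] at h2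
  omega

theorem two_le_entry (h : Final s m) {p : ℕ} (hp : numLeaves s < p) (hpn : p ≤ n) :
    2 ≤ entry s p := MaxNullity.two_le_entry h.mono h.pos hp hpn

theorem kap_n (h : Final s m) : kap s n = entry s n := by
  have h1 := h.kap_sub h.low_le le_rfl
  have h2 := h.kap_add (show n + 1 ≤ n + 1 by omega)
  have h3 := h.excess_eq
  rw [Nat.add_sub_cancel] at h2
  have h4 := h.leaves_lt_low
  have h5 := h.low_le
  have h6 := h.two_le_entry (show numLeaves s < n by omega) le_rfl
  omega

theorem eta_sub (h : Final s m) {r : ℕ} (hr : r < m) :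
    eta s r = eta s (r + 1) + (entry s (numLeaves s + r + 1) - 1) := by
  have h1 := h.eta_add hr.le
  have h2 := h.eta_add (show r + 1 ≤ m by omega)
  have h3 := excess_succ s (numLeaves s + r)
  rw [← Nat.add_assoc] at h2
  omega

/-- The intervals `[eta (r+1), eta r)` for `r < m` partition the top vertices other than `v_n`; the
interval containing `j` names its hub. -/
theorem exists_round (h : Final s m) {j : ℕ} (hj : eta s m ≤ j) (hjn : j < n) :
    ∃ r < m, eta s (r + 1) ≤ j ∧ j < eta s r := by
  have hex : ∃ r, eta s r ≤ j := ⟨m, hj⟩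
  have h1 := Nat.find_spec hex
  have h2 : Nat.find hex ≤ m := Nat.find_le hj
  have h3 : Nat.find hex ≠ 0 := fun h3 => by
    rw [h3, h.eta_zero] at h1
    omega
  obtain ⟨r, hr⟩ := Nat.exists_eq_succ_of_ne_zero h3
  refine ⟨r, by omega, ?_, ?_⟩
  · rwa [hr] at h1
  · exact not_le.1 (Nat.find_min hex (m := r) (by omega))

/-- The intervals `(kap (j+1), kap j]` for `low ≤ j < n`, together with `[1, kap n]`, partition the
bottom; the interval containing `c` names its parent. -/
theorem exists_block (h : Final s m) {c : ℕ} (hc : c < eta s m) :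
    ∃ j, low s m ≤ j ∧ j ≤ n ∧ c ≤ kap s j ∧ (j = n ∨ kap s (j + 1) < c) := by
  by_cases h0 : c ≤ kap s n
  · exact ⟨n, h.low_le, le_rfl, h0, Or.inl rfl⟩
  have h1 := h.kap_low
  have hex : ∃ d, kap s (low s m + d) < c :=
    ⟨n - low s m, by rw [Nat.add_sub_cancel' h.low_le]; omega⟩
  have h2 := Nat.find_spec hex
  have h3 : Nat.find hex ≤ n - low s m :=
    Nat.find_le (by rw [Nat.add_sub_cancel' h.low_le]; omega)
  have h4 : Nat.find hex ≠ 0 := fun h4 => by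
    rw [h4, Nat.add_zero] at h2
    omega
  obtain ⟨d, hd⟩ := Nat.exists_eq_succ_of_ne_zero h4
  have h5 := not_lt.1 (Nat.find_min hex (m := d) (by omega))
  rw [hd] at h2
  exact ⟨low s m + d, by omega, by have := h.low_le; omega, h5, Or.inr h2⟩

theorem round_unique (h : Final s m) {j r r' : ℕ} (hr : r < m) (hr' : r' < m)
    (h1 : eta s (r + 1) ≤ j) (h2 : j < eta s r) (h1' : eta s (r' + 1) ≤ j) (h2' : j < eta s r') :
    r = r' := by
  rcases lt_trichotomy r r' with h3 | h3 | h3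
  · have := h.eta_le (show r + 1 ≤ r' by omega) (by omega)
    omega
  · exact h3
  · have := h.eta_le (show r' + 1 ≤ r by omega) (by omega)
    omega

theorem block_unique (h : Final s m) {c j j' : ℕ} (hj : low s m ≤ j) (hj' : low s m ≤ j')
    (hn : j ≤ n) (hn' : j' ≤ n) (h1 : c ≤ kap s j) (h2 : j = n ∨ kap s (j + 1) < c)
    (h1' : c ≤ kap s j') (h2' : j' = n ∨ kap s (j' + 1) < c) : j = j' := by
  rcases lt_trichotomy j j' with h3 | h3 | h3
  · have := h.kap_le (show low s m ≤ j + 1 by omega) (show j + 1 ≤ j' by omega) (by omega)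
    omega
  · exact h3
  · have := h.kap_le (show low s m ≤ j' + 1 by omega) (show j' + 1 ≤ j by omega) (by omega)
    omega

/-- The bottom vertex `c` is joined to the top vertex `j`. -/
def Joined (s : Fin n → ℕ) (m c j : ℕ) : Prop :=
  (∃ r < m, c = hub s r ∧ eta s (r + 1) ≤ j ∧ j < eta s r) ∨
    (low s m ≤ j ∧ c ≤ kap s j ∧ (j = n ∨ kap s (j + 1) < c))

theorem mem_edges_iff (h : Final s m) {p c : ℕ} (hp : p ≤ n) (hc : 1 ≤ c) :
    (p, c) ∈ (run s).edges ↔ (∃ r < m, p = hub s r ∧ eta s (r + 1) ≤ c ∧ c < eta s r) ∨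
      (low s m ≤ p ∧ c ≤ kap s p ∧ (p = n ∨ kap s (p + 1) < c)) := by
  rw [h.inv.edges, IsParent]
  refine or_congr (exists_congr fun r => and_congr_right fun hr => and_congr Iff.rfl ?_) ?_
  · have h1 := h.eta_add hr.le
    have h2 := h.eta_add (show r + 1 ≤ m by omega)
    rw [← Nat.add_assoc] at h2
    omega
  · have h1 := h.kap_add (show p ≤ n + 1 by omega)
    have h2 := h.kap_add (show p + 1 ≤ n + 1 by omega)
    rw [Nat.add_sub_cancel] at h2
    omega

theorem adj_iff_of_lt (h : Final s m) {u v : Fin n} (hu : u.val + 1 < eta s m)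
    (hv : eta s m ≤ v.val + 1) :
    (tree s).Adj u v ↔ Joined s m (u.val + 1) (v.val + 1) := by
  have hne : u ≠ v := by rintro rfl; omega
  have h1 := h.eta_le_low
  rw [tree, SimpleGraph.fromRel_adj, h.mem_edges_iff (by omega) (by omega),
    h.mem_edges_iff (by omega) (by omega), Joined]
  constructor
  · rintro ⟨-, (h2 | h2) | ⟨r, hr, h2, -⟩ | h2⟩
    · exact Or.inl h2
    · omega
    · have := h.hub_lt_eta hr
      omega
    · exact Or.inr h2
  · rintro (h2 | h2)
    · exact ⟨hne, Or.inl (Or.inl h2)⟩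
    · exact ⟨hne, Or.inr (Or.inr h2)⟩

/-- Bipartiteness: hubs and the children of processed vertices lie below `eta m`; processed vertices
and the children of hubs do not. -/
theorem lt_iff_of_adj (h : Final s m) {u v : Fin n} (huv : (tree s).Adj u v) :
    u.val + 1 < eta s m ↔ eta s m ≤ v.val + 1 := by
  have h1 := h.eta_le_low
  rw [tree, SimpleGraph.fromRel_adj, h.mem_edges_iff (by omega) (by omega),
    h.mem_edges_iff (by omega) (by omega)] at huv
  obtain ⟨-, (⟨r, hr, h2, h3, -⟩ | ⟨h2, h3, -⟩) | ⟨r, hr, h2, h3, -⟩ | ⟨h2, h3, -⟩⟩ := huv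
  · have := h.hub_lt_eta hr
    have := h.eta_le (show r + 1 ≤ m by omega) le_rfl
    omega
  · have := h.kap_lt_eta h2 (by omega)
    omega
  · have := h.hub_lt_eta hr
    have := h.eta_le (show r + 1 ≤ m by omega) le_rfl
    omega
  · have := h.kap_lt_eta h2 (by omega)
    omega

theorem joined_of_adj (h : Final s m) {u v : Fin n} (huv : (tree s).Adj u v)
    (hu : u.val + 1 < eta s m) : eta s m ≤ v.val + 1 ∧ Joined s m (u.val + 1) (v.val + 1) := by
  have := (h.lt_iff_of_adj huv).1 hu
  exact ⟨this, (h.adj_iff_of_lt hu this).1 huv⟩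

theorem joined_of_adj' (h : Final s m) {u v : Fin n} (huv : (tree s).Adj u v)
    (hu : eta s m ≤ u.val + 1) : v.val + 1 < eta s m ∧ Joined s m (v.val + 1) (u.val + 1) := by
  have := (h.lt_iff_of_adj huv.symm).2 hu
  exact ⟨this, (h.adj_iff_of_lt this hu).1 huv.symm⟩

theorem exists_vertex {p : ℕ} (h1 : 1 ≤ p) (h2 : p ≤ n) : ∃ v : Fin n, v.val + 1 = p :=
  ⟨⟨p - 1, by omega⟩, Nat.sub_add_cancel h1⟩

theorem hub_le (h : Final s m) {r : ℕ} (hr : r < m) : hub s r ≤ n := by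
  have := h.hub_lt_eta hr
  have := eta_le_n s m
  omega

theorem joined_hub (h : Final s m) {r : ℕ} (hr : r < m) : Joined s m (hub s r) (eta s r) := by
  refine Or.inr ⟨h.low_le_eta hr, le_rfl, ?_⟩
  have h1 := eta_le_n s r
  by_cases h2 : eta s r = n
  · exact Or.inl h2
  · exact Or.inr (h.kap_lt (h.low_le_eta hr) (by omega) (by omega))

theorem connected (h : Final s m) : (tree s).Connected := by
  have hn := h.three_le
  obtain ⟨root, hroot⟩ := exists_vertex (n := n) (p := n) (by omega) le_rfl
  -- Ascent to `v_n`: from a top vertex go to its hub `hub r`, then to the parent `eta r` of that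
  -- hub, which has a larger index.
  have htop : ∀ d, ∀ v : Fin n, eta s m ≤ v.val + 1 → v.val + 1 + d = n →
      (tree s).Reachable v root := by
    intro d
    induction d using Nat.strong_induction_on with
    | _ d ih =>
    intro v hv hd
    by_cases hd0 : d = 0
    · have : v = root := Fin.ext (by omega)
      rw [this]
    obtain ⟨r, hr, h1, h2⟩ := h.exists_round hv (by omega)
    obtain ⟨x, hx⟩ := exists_vertex (h.one_le_hub r) (h.hub_le hr)
    have hxe := h.hub_lt_eta hr
    have h3 := h.eta_le hr.le le_rfl
    obtain ⟨w, hw⟩ := exists_vertex (n := n) (p := eta s r) (by omega) (eta_le_n s r)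
    have hxv : (tree s).Adj x v := by
      rw [h.adj_iff_of_lt (by omega) hv]
      exact Or.inl ⟨r, hr, hx, h1, h2⟩
    have hxw : (tree s).Adj x w := by
      rw [h.adj_iff_of_lt (by omega) (by omega), hx, hw]
      exact h.joined_hub hr
    exact (hxv.symm.reachable.trans hxw.reachable).trans
      (ih (n - eta s r) (by omega) w (by omega) (by have := eta_le_n s r; omega))
  have hall : ∀ v, (tree s).Reachable v root := by
    intro v
    by_cases hv : eta s m ≤ v.val + 1
    · exact htop (n - (v.val + 1)) v hv (by omega)
    · obtain ⟨j, h1, h2, h3, h4⟩ := h.exists_block (not_le.1 hv)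
      obtain ⟨w, hw⟩ := exists_vertex (n := n) (p := j) (by have := h.leaves_lt_low; omega) h2
      have hw' : eta s m ≤ w.val + 1 := by have := h.eta_le_low; omega
      have hvw : (tree s).Adj v w := by
        rw [h.adj_iff_of_lt (by omega) hw', hw]
        exact Or.inr ⟨h1, h3, h4⟩
      exact hvw.reachable.trans (htop (n - (w.val + 1)) w hw' (by omega))
  have : Nonempty (Fin n) := ⟨root⟩
  exact ⟨fun u v => (hall u).trans (hall v).symm⟩

end Final

/-! ### Degrees of the output -/

open Classical in
theorem degree_le_card {G : SimpleGraph (Fin n)} {v : Fin n} {A : Finset ℕ}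
    (h : ∀ w, G.Adj v w → w.val + 1 ∈ A) : G.degree v ≤ A.card := by
  rw [← SimpleGraph.card_neighborFinset_eq_degree]
  refine Finset.card_le_card_of_injOn (fun w => w.val + 1) (fun w hw => ?_) ?_
  · exact h w (by simpa using hw)
  · intro a _ b _ hab
    exact Fin.ext (by simpa using hab)

namespace Final

open Classical in
-- `v_n` has at most `kap n = d_n` neighbours; any other processed vertex has its hub and at most
-- `kap j - kap (j+1) = d_j - 1` children. Upper bounds suffice here, since the edge count later
-- turns them into equalities.
theorem degree_le_entry_of_low_le (h : Final s m) {v : Fin n} (hv : low s m ≤ v.val + 1) :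
    (tree s).degree v ≤ s v := by
  have h1 := h.eta_le_low
  have h2 := h.leaves_lt_low
  have h3 := h.two_le_entry (p := v.val + 1) (by omega) (by omega)
  rw [← entry_succ (s := s) v]
  by_cases hvn : v.val + 1 = n
  · refine (degree_le_card (A := Finset.Icc 1 (kap s n)) fun w hw => ?_).trans ?_
    · obtain ⟨-, ⟨r, hr, -, -, h4⟩ | h4⟩ := h.joined_of_adj' hw (by omega)
      · have := eta_le_n s r
        omega
      · rw [hvn] at h4
        rw [Finset.mem_Icc]
        omega
    · rw [Nat.card_Icc, h.kap_n, hvn]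
      omega
  · obtain ⟨r, hr, h4, h5⟩ := h.exists_round (j := v.val + 1) (by omega) (by omega)
    refine (degree_le_card (A := insert (hub s r)
      (Finset.Ioc (kap s (v.val + 1 + 1)) (kap s (v.val + 1)))) fun w hw => ?_).trans ?_
    · obtain ⟨-, ⟨r', hr', h6, h7, h8⟩ | h6⟩ := h.joined_of_adj' hw (by omega)
      · rw [h6, h.round_unique hr' hr h7 h8 h4 h5]
        exact Finset.mem_insert_self _ _
      · refine Finset.mem_insert_of_mem (Finset.mem_Ioc.2 ?_)
        omega
    · refine (Finset.card_insert_le _ _).trans ?_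
      rw [Nat.card_Ioc]
      have := h.kap_sub hv (by omega)
      omega

open Classical in
theorem degree_le_entry_of_eq_hub (h : Final s m) {v : Fin n} {r : ℕ} (hr : r < m)
    (hv : v.val + 1 = hub s r) : (tree s).degree v ≤ entry s (numLeaves s + r + 1) := by
  have h1 := h.low_le
  have h2 := h.leaves_lt_low
  have h3 := h.two_le_entry (p := numLeaves s + r + 1) (by omega) (by omega)
  have h4 := h.hub_lt_eta hr
  have h5 := eta_le_n s r
  have h6 := h.eta_le_low
  refine (degree_le_card (A := insert (eta s r)
    (Finset.Ico (eta s (r + 1)) (eta s r))) fun w hw => ?_).trans ?_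
  · obtain ⟨-, ⟨r', hr', h7, h8, h9⟩ | h7⟩ := h.joined_of_adj hw (by omega)
    · obtain rfl := h.hub_inj hr hr' (by omega)
      exact Finset.mem_insert_of_mem (Finset.mem_Ico.2 ⟨h8, h9⟩)
    · obtain h8 | h8 := h.joined_hub hr
      · obtain ⟨r', hr', h8, h9, h10⟩ := h8
        obtain rfl := h.hub_inj hr hr' h8
        omega
      · rw [hv] at h7
        rw [h.block_unique h7.1 h8.1 (by omega) h5 h7.2.1 h7.2.2 h8.2.1 h8.2.2]
        exact Finset.mem_insert_self _ _
  · refine (Finset.card_insert_le _ _).trans ?_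
    rw [Nat.card_Ico]
    have := h.eta_sub hr
    omega

open Classical in
theorem degree_le_one (h : Final s m) {v : Fin n} (hv : v.val + 1 < low s m)
    (hv' : ∀ r < m, v.val + 1 ≠ hub s r) : (tree s).degree v ≤ 1 := by
  have hln := h.low_le
  by_cases htop : eta s m ≤ v.val + 1
  · obtain ⟨r, hr, h4, h5⟩ := h.exists_round htop (by omega)
    refine (degree_le_card (A := {hub s r}) fun w hw => ?_).trans (Finset.card_singleton _).le
    obtain ⟨-, ⟨r', hr', h6, h7, h8⟩ | h6⟩ := h.joined_of_adj' hw htop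
    · rw [h6, h.round_unique hr' hr h7 h8 h4 h5]
      exact Finset.mem_singleton_self _
    · omega
  · obtain ⟨j, h1, h2, h3, h4⟩ := h.exists_block (not_le.1 htop)
    refine (degree_le_card (A := {j}) fun w hw => ?_).trans (Finset.card_singleton _).le
    obtain ⟨-, ⟨r', hr', h6, h7, h8⟩ | h6⟩ := h.joined_of_adj hw (by omega)
    · exact absurd h6 (hv' r' hr')
    · rw [h.block_unique h6.1 h1 (by omega) h2 h6.2.1 h6.2.2 h3 h4]
      exact Finset.mem_singleton_self _

open Classical in
/-- The internal vertices of the output correspond to the entries greater than `1`. -/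
theorem exists_perm (h : Final s m) : ∃ σ : Equiv.Perm (Fin n),
    (∀ r, (tree s).degree (σ r) ≤ s r) ∧ ∀ r, numLeaves s ≤ r.val ↔
      (low s m ≤ (σ r).val + 1 ∨ ∃ i < m, (σ r).val + 1 = hub s i) := by
  have h1 := h.low_le
  have h2 := h.leaves_lt_low
  have h3 := h.eta_le_low
  -- Indices from `low - 1` on (counted from `0`) belong to the processed vertices themselves, and
  -- the index `l + i` with `i < m` and `l = numLeaves s` belongs to `hub i`. The entries equal to
  -- `1` may be distributed arbitrarily over the remaining vertices.
  have hex : ∀ r : {r : Fin n // numLeaves s ≤ r.val}, ∃ v : Fin n,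
      (low s m ≤ r.1.val + 1 ∧ v = r.1) ∨
        (r.1.val + 1 < low s m ∧ v.val + 1 = hub s (r.1.val - numLeaves s)) := by
    rintro ⟨r, hr⟩
    by_cases h4 : low s m ≤ r.val + 1
    · exact ⟨r, Or.inl ⟨h4, rfl⟩⟩
    · obtain ⟨v, hv⟩ := exists_vertex (h.one_le_hub (r.val - numLeaves s))
        (h.hub_le (show r.val - numLeaves s < m by omega))
      exact ⟨v, Or.inr ⟨not_le.1 h4, hv⟩⟩
  choose g hg using hex
  have hhub : ∀ r : {r : Fin n // numLeaves s ≤ r.val}, r.1.val + 1 < low s m →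
      r.1.val - numLeaves s < m := by
    intro r hr
    have := r.2
    omega
  have hlt : ∀ r : {r : Fin n // numLeaves s ≤ r.val}, r.1.val + 1 < low s m →
      hub s (r.1.val - numLeaves s) < eta s m := fun r hr => h.hub_lt_eta (hhub r hr)
  have hinj : Function.Injective g := by
    intro a b hab
    rcases hg a with ⟨h4, h5⟩ | ⟨h4, h5⟩ <;> rcases hg b with ⟨h6, h7⟩ | ⟨h6, h7⟩
    · exact Subtype.ext (by rw [← h5, ← h7, hab])
    · have := hlt b h6
      rw [← hab, h5] at h7
      omega
    · have := hlt a h4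
      rw [hab, h7] at h5
      omega
    · rw [hab] at h5
      have h8 := h.hub_inj (hhub a h4) (hhub b h6) (by omega)
      have := a.2
      have := b.2
      exact Subtype.ext (Fin.ext (by omega))
  have hrange : ∀ v, v ∈ Set.range g ↔ (low s m ≤ v.val + 1 ∨ ∃ i < m, v.val + 1 = hub s i) := by
    intro v
    constructor
    · rintro ⟨r, rfl⟩
      rcases hg r with ⟨h4, h5⟩ | ⟨h4, h5⟩
      · exact Or.inl (by rw [h5]; exact h4)
      · exact Or.inr ⟨_, hhub r h4, h5⟩
    · rintro (h4 | ⟨i, hi, h4⟩)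
      · refine ⟨⟨v, by omega⟩, ?_⟩
        rcases hg ⟨v, by omega⟩ with ⟨h5, h6⟩ | ⟨h5, h6⟩
        · exact h6
        · change v.val + 1 < _ at h5
          omega
      · refine ⟨⟨⟨numLeaves s + i, by omega⟩, by simp⟩, ?_⟩
        rcases hg ⟨⟨numLeaves s + i, by omega⟩, by simp⟩ with ⟨h5, h6⟩ | ⟨h5, h6⟩
        · change _ ≤ numLeaves s + i + 1 at h5
          omega
        · simp only [Nat.add_sub_cancel_left] at h6
          exact Fin.ext (by omega)
  let e : {r : Fin n // numLeaves s ≤ r.val} ≃ {v : Fin n // v ∈ Set.range g} :=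
    Equiv.ofInjective g hinj
  have he : ∀ (r : Fin n) (hr : numLeaves s ≤ r.val), e.extendSubtype r = g ⟨r, hr⟩ :=
    fun r hr => e.extendSubtype_apply_of_mem r hr
  have he' : ∀ r : Fin n, ¬ numLeaves s ≤ r.val → e.extendSubtype r ∉ Set.range g :=
    fun r hr => e.extendSubtype_not_mem r hr
  refine ⟨e.extendSubtype, fun r => ?_, fun r => ?_⟩
  · by_cases hr : numLeaves s ≤ r.val
    · rw [he r hr]
      rcases hg ⟨r, hr⟩ with ⟨h4, h5⟩ | ⟨h4, h5⟩
      · rw [h5]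
        exact h.degree_le_entry_of_low_le h4
      · have h6 := h.degree_le_entry_of_eq_hub (hhub ⟨r, hr⟩ h4) h5
        simp only at h6
        rwa [Nat.add_sub_cancel' hr, entry_succ] at h6
    · have h4 := he' r hr
      rw [hrange, not_or] at h4
      refine (h.degree_le_one (not_le.1 h4.1) fun i hi h5 => h4.2 ⟨i, hi, h5⟩).trans (h.pos r)
  · rw [← hrange]
    constructor
    · intro hr
      rw [he r hr]
      exact ⟨_, rfl⟩
    · intro hr
      by_contra h4
      exact he' r h4 hr

open Classical in
-- Connectedness gives degree sum at least `2n - 2`, and the bounds on the degrees give at most `∑ s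
-- = 2n - 2`. Hence there are exactly `n - 1` edges and every degree bound is sharp.
theorem isTree_and_exists_perm (h : Final s m) :
    (tree s).IsTree ∧ ∃ σ : Equiv.Perm (Fin n),
    (∀ r, (tree s).degree (σ r) = s r) ∧ ∀ r, numLeaves s ≤ r.val ↔
      (low s m ≤ (σ r).val + 1 ∨ ∃ i < m, (σ r).val + 1 = hub s i) := by
  obtain ⟨σ, h1, h2⟩ := h.exists_perm
  have hsum := h.sum_eq
  have h3 := (tree s).sum_degrees_eq_twice_card_edges
  have h4 := h.connected.card_vert_le_card_edgeSet_add_one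
  rw [Nat.card_eq_fintype_card, Fintype.card_fin, Nat.card_eq_fintype_card,
    ← SimpleGraph.edgeFinset_card] at h4
  rw [← Equiv.sum_comp σ] at h3
  have h5 := Finset.sum_le_sum fun r (_ : r ∈ Finset.univ) => h1 r
  refine ⟨?_, σ, fun r => ?_, h2⟩
  · rw [SimpleGraph.isTree_iff_connected_and_card]
    refine ⟨h.connected, ?_⟩
    rw [Nat.card_eq_fintype_card, Nat.card_eq_fintype_card, Fintype.card_fin,
      ← SimpleGraph.edgeFinset_card]
    omega
  · exact (Finset.sum_eq_sum_iff_of_le fun r _ => h1 r).1 (by omega) r (Finset.mem_univ _)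

end Final

end MaxNullity

/-! ### An independent set of size `a(s)` -/

namespace MaxNullity

variable {n : ℕ} {s : Fin n → ℕ} {m : ℕ}

/-- The vertices which are not leaves of the output. -/
def Internal (s : Fin n → ℕ) (m : ℕ) (v : Fin n) : Prop :=
  low s m ≤ v.val + 1 ∨ ∃ i < m, v.val + 1 = hub s i

open Classical in
/-- A maximum independent set of the output. -/
noncomputable def indepSet (s : Fin n → ℕ) (m : ℕ) : Finset (Fin n) :=
  Finset.univ.filter fun v => v.val + 1 < low s m ∧
    ¬ (eta s m < low s m ∧ v.val + 1 = hub s (m - 1))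

theorem mem_indepSet {v : Fin n} : v ∈ indepSet s m ↔ v.val + 1 < low s m ∧
    ¬ (eta s m < low s m ∧ v.val + 1 = hub s (m - 1)) := by
  simp [indepSet]

namespace Final

theorem isTree (h : Final s m) : (tree s).IsTree := h.isTree_and_exists_perm.1

theorem hasDegreeSequence (h : Final s m) : HasDegreeSequence (tree s) s := by
  classical
  obtain ⟨-, σ, h1, -⟩ := h.isTree_and_exists_perm
  rw [HasDegreeSequence]
  have h2 : Multiset.map σ Finset.univ.val = Finset.univ.val :=
    congrArg Finset.val (Finset.map_univ_equiv σ)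
  conv_lhs => rw [← h2]
  rw [Multiset.map_map]
  refine Multiset.map_congr rfl fun r _ => ?_
  rw [← h1 r]
  rfl

theorem ncard_neighborSet (h : Final s m) (v : Fin n) :
    ((tree s).neighborSet v).ncard = 1 ∧ ¬ Internal s m v ∨
      1 < ((tree s).neighborSet v).ncard ∧ Internal s m v := by
  classical
  obtain ⟨-, σ, h1, h2⟩ := h.isTree_and_exists_perm
  obtain ⟨r, rfl⟩ := σ.surjective v
  have h3 : ((tree s).neighborSet (σ r)).ncard = s r := by
    rw [← h1 r, ← Nat.card_coe_set_eq, Nat.card_eq_fintype_card,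
      SimpleGraph.card_neighborSet_eq_degree]
  have h4 := lt_numLeaves_iff h.mono h.pos r
  have h5 := h.pos r
  rw [h3, Internal, ← h2 r]
  omega

theorem leaf_iff (h : Final s m) {v : Fin n} :
    ((tree s).neighborSet v).ncard = 1 ↔ ¬ Internal s m v := by
  rcases h.ncard_neighborSet v with h1 | h1
  · simp [h1]
  · simp [h1, h1.1.ne']

theorem internal_iff (h : Final s m) {v : Fin n} :
    1 < ((tree s).neighborSet v).ncard ↔ Internal s m v := by
  rcases h.ncard_neighborSet v with h1 | h1
  · simp [h1]
  · simp [h1]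

theorem pos_of_eta_lt (h : Final s m) (hlt : eta s m < low s m) : 0 < m := by
  by_contra h0
  obtain rfl : m = 0 := by omega
  have h1 := h.eta_zero
  have h2 := h.low_le
  omega

/-- A top vertex below `low` has only its hub as neighbour. Since `low ≤ eta r` for `r < m`, that
hub can only be the last one, which is then excluded. -/
theorem isIndepSet (h : Final s m) : (tree s).IsIndepSet (indepSet s m : Set (Fin n)) := by
  have key : ∀ u ∈ indepSet s m, ∀ v ∈ indepSet s m, u.val + 1 < eta s m →
      ¬ (tree s).Adj u v := by
    intro u hu v hv hue huv
    rw [mem_indepSet] at hu hv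
    obtain ⟨h1, ⟨r, hr, h2, h3, h4⟩ | ⟨h2, -⟩⟩ := h.joined_of_adj huv hue
    · by_cases hr' : r + 1 < m
      · have := h.low_le_eta hr'
        omega
      · obtain rfl : r = m - 1 := by omega
        exact hu.2 ⟨by omega, h2⟩
    · omega
  intro u hu v hv _ huv
  by_cases hue : u.val + 1 < eta s m
  · exact key u hu v hv hue huv
  · exact key v hv u hu ((h.lt_iff_of_adj huv.symm).2 (by omega)) huv.symm

theorem card_indepSet (h : Final s m) :
    (indepSet s m).card + 1 + (if eta s m < low s m then 1 else 0) = low s m := by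
  classical
  have h0 := h.low_le
  have h1 := h.leaves_lt_low
  have h2 : (Finset.univ.filter fun v : Fin n => v.val + 1 < low s m).card = low s m - 1 := by
    have : (Finset.univ.filter fun v : Fin n => v.val + 1 < low s m) =
        Finset.univ.map (Fin.castLEEmb (show low s m - 1 ≤ n by omega)) := by
      ext i
      simp only [Finset.mem_filter, Finset.mem_univ, true_and, Finset.mem_map, Fin.castLEEmb_apply]
      exact ⟨fun h => ⟨⟨i, by omega⟩, rfl⟩, by rintro ⟨a, rfl⟩; have := a.2; simp; omega⟩
    rw [this, Finset.card_map, Finset.card_univ, Fintype.card_fin]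
  split_ifs with hlt
  · have hm := h.pos_of_eta_lt hlt
    obtain ⟨y, hy⟩ := exists_vertex (h.one_le_hub (m - 1)) (h.hub_le (show m - 1 < m by omega))
    have h3 := h.hub_lt_eta (show m - 1 < m by omega)
    have h4 : indepSet s m = (Finset.univ.filter fun v : Fin n => v.val + 1 < low s m).erase y := by
      ext v
      rw [mem_indepSet, Finset.mem_erase, Finset.mem_filter, Ne, Fin.ext_iff]
      simp only [Finset.mem_univ, true_and]
      omega
    have h5 : y ∈ Finset.univ.filter fun v : Fin n => v.val + 1 < low s m := by
      simp only [Finset.mem_filter, Finset.mem_univ, true_and]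
      omega
    have h6 := Finset.card_pos.2 ⟨y, h5⟩
    rw [h4, Finset.card_erase_of_mem h5, h2]
    omega
  · have h4 : indepSet s m = Finset.univ.filter fun v : Fin n => v.val + 1 < low s m := by
      ext v
      rw [mem_indepSet, Finset.mem_filter]
      simp [hlt]
    rw [h4, h2]
    omega

/-- The definition of `a` says `a + excess s a ≤ n - 1`, and `excess s (l + m) = n - eta m`, where
`l = numLeaves s`. If `eta m < low`, then `a ≥ l + m` makes the left side at least `n`; if `eta m =
low`, then so does `a ≥ l + m + 1`. -/
theorem annihilationNumber_le (h : Final s m) : annihilationNumber s ≤ (indepSet s m).card := by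
  have h1 := h.card_indepSet
  have h2 := h.sum_eq
  set a := annihilationNumber s with ha
  have ha1 : a ≤ n := Nat.findGreatest_le n
  have ha2 : 2 * ∑ i with i.val < a, s i ≤ ∑ i, s i :=
    Nat.findGreatest_spec (P := fun a => 2 * ∑ i with i.val < a, s i ≤ ∑ i, s i) (Nat.zero_le n)
      (by simp)
  rw [sum_filter_lt_eq ha1 h.pos] at ha2
  have h3 := h.eta_add le_rfl
  have h4 := h.leaves_lt_low
  have h5 := h.eta_le_low
  by_contra hlt
  split_ifs at h1 with h6
  · have := excess_mono s (show numLeaves s + m ≤ a by omega)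
    omega
  · have := excess_lt h.mono h.pos (show numLeaves s ≤ numLeaves s + m by omega)
      (show numLeaves s + m < a by omega) ha1
    omega

theorem VK_eq (h : Final s m) : (run s).VK = (List.range m).map (hub s) := h.inv.VK_eq

theorem mem_setVK (h : Final s m) {v : Fin n} : v ∈ setVK s ↔ ∃ r < m, v.val + 1 = hub s r := by
  change v.val + 1 ∈ (run s).VK ↔ _
  rw [h.VK_eq]
  simp [eq_comm]

theorem head?_VK (h : Final s m) (hm : 0 < m) : (run s).VK.head? = some (hub s 0) := by
  obtain ⟨k, rfl⟩ := Nat.exists_eq_succ_of_ne_zero hm.ne'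
  rw [h.VK_eq, List.range_succ_eq_map]
  rfl

theorem getLast?_VK (h : Final s m) (hm : 0 < m) :
    (run s).VK.getLast? = some (hub s (m - 1)) := by
  obtain ⟨k, rfl⟩ := Nat.exists_eq_succ_of_ne_zero hm.ne'
  rw [h.VK_eq, Nat.succ_eq_add_one, List.range_succ, List.map_append]
  simp

theorem getVert_lt_iff (h : Final s m) {x y : Fin n} (P : (tree s).Walk x y)
    (hx : x.val + 1 < eta s m) {i : ℕ} (hi : i ≤ P.length) :
    (P.getVert i).val + 1 < eta s m ↔ Even i := by
  induction i with
  | zero => simpa using hx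
  | succ i ih =>
    have h1 := ih (by omega)
    have h2 := h.lt_iff_of_adj (P.adj_getVert_succ (show i < P.length by omega))
    rw [Nat.even_add_one, ← h1]
    omega

/-- An inner vertex of a path has two distinct neighbours. -/
theorem leaf_notMem_support (h : Final s m) {x y w : Fin n} {P : (tree s).Walk x y}
    (hP : P.IsPath) (hx : Internal s m x) (hy : Internal s m y) (hw : ¬ Internal s m w) :
    w ∉ P.support := by
  intro hmem
  obtain ⟨i, rfl, hi⟩ := SimpleGraph.Walk.mem_support_iff_exists_getVert.1 hmem
  have h0 : i ≠ 0 := by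
    rintro rfl
    rw [P.getVert_zero] at hw
    exact hw hx
  have h1 : i ≠ P.length := by
    rintro rfl
    rw [P.getVert_length] at hw
    exact hw hy
  obtain ⟨j, rfl⟩ := Nat.exists_eq_succ_of_ne_zero h0
  rw [Nat.succ_eq_add_one] at *
  obtain ⟨a, ha⟩ := Set.ncard_eq_one.1 (h.leaf_iff.2 hw)
  have h2 : P.getVert j ∈ (tree s).neighborSet (P.getVert (j + 1)) :=
    (P.adj_getVert_succ (by omega)).symm
  have h3 : P.getVert (j + 1 + 1) ∈ (tree s).neighborSet (P.getVert (j + 1)) :=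
    P.adj_getVert_succ (by omega)
  rw [ha, Set.mem_singleton_iff] at h2 h3
  have := hP.getVert_injOn (show j ≤ P.length by omega) (show j + 1 + 1 ≤ P.length by omega)
    (h2.trans h3.symm)
  omega

end Final

/-! ### The accompanying matchings -/

/-- The first, third, fifth, … edge of `P`, and the edges `v f(v)` for `v ∈ S`. -/
def pathMatching {G : SimpleGraph (Fin n)} {x y : Fin n} (P : G.Walk x y) (S : Set (Fin n))
    (f : Fin n → Fin n) : Set (Sym2 (Fin n)) :=
  {e | ∃ i, 2 * i + 1 ≤ P.length ∧ e = s(P.getVert (2 * i), P.getVert (2 * i + 1))} ∪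
    {e | ∃ v ∈ S, e = s(v, f v)}

namespace Final

theorem internal_hub {v : Fin n} {r : ℕ} (hr : r < m) (hv : v.val + 1 = hub s r) :
    Internal s m v := Or.inr ⟨r, hr, hv⟩

theorem isEdgeMatching (h : Final s m) {x y : Fin n} {P : (tree s).Walk x y} (hP : P.IsPath)
    {S : Set (Fin n)} {f : Fin n → Fin n} (hx : x.val + 1 < eta s m) (hy : y.val + 1 < eta s m)
    (hxi : Internal s m x) (hyi : Internal s m y)
    (hS : ∀ v ∈ S, Internal s m v ∧ (v ∈ P.support → v = y))
    (hf : ∀ v ∈ S, IsLeafAt (tree s) v (f v)) : IsEdgeMatching (tree s) (pathMatching P S f) := by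
  -- Both ends are bottom vertices, so the last edge of `P` is not among the chosen ones and `y`
  -- remains free for a leaf edge.
  have hlen : Even P.length := by
    rw [← h.getVert_lt_iff P hx le_rfl, P.getVert_length]
    exact hy
  have hfl : ∀ v ∈ S, ¬ Internal s m (f v) := fun v hv => h.leaf_iff.1 (hf v hv).2
  have hpath : ∀ i, 2 * i + 1 ≤ P.length → ∀ w ∈ s(P.getVert (2 * i), P.getVert (2 * i + 1)),
      w ∈ P.support ∧ w ≠ y := by
    intro i hi w hw
    have h1 : 2 * i + 1 ≠ P.length := fun h1 => by
      rw [← h1] at hlen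
      exact absurd hlen (by simp)
    rcases Sym2.mem_iff.1 hw with rfl | rfl
    · refine ⟨P.getVert_mem_support _, fun h2 => ?_⟩
      rw [hP.getVert_eq_end_iff (by omega)] at h2
      omega
    · refine ⟨P.getVert_mem_support _, fun h2 => ?_⟩
      rw [hP.getVert_eq_end_iff (by omega)] at h2
      omega
  have hdisj : ∀ i, 2 * i + 1 ≤ P.length → ∀ v ∈ S,
      ∀ w ∈ s(P.getVert (2 * i), P.getVert (2 * i + 1)), w ∉ s(v, f v) := by
    intro i hi v hv w hw hw'
    obtain ⟨h1, h2⟩ := hpath i hi w hw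
    rcases Sym2.mem_iff.1 hw' with rfl | rfl
    · exact h2 ((hS w hv).2 h1)
    · exact h.leaf_notMem_support hP hxi hyi (hfl v hv) h1
  refine ⟨?_, ?_⟩
  · rintro e (⟨i, hi, rfl⟩ | ⟨v, hv, rfl⟩)
    · exact P.adj_getVert_succ (by omega)
    · exact (hf v hv).1
  · rintro e (⟨i, hi, rfl⟩ | ⟨v, hv, rfl⟩) e' (⟨j, hj, rfl⟩ | ⟨v', hv', rfl⟩) w hw hw'
    · have hinj : ∀ a b, a ≤ P.length → b ≤ P.length → P.getVert a = P.getVert b → a = b :=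
        fun a b ha hb hab => hP.getVert_injOn ha hb hab
      have : i = j := by
        rcases Sym2.mem_iff.1 hw with rfl | rfl <;> rcases Sym2.mem_iff.1 hw' with h1 | h1 <;>
        · have := hinj _ _ (by omega) (by omega) h1
          omega
      rw [this]
    · exact absurd hw' (hdisj i hi v' hv' w hw)
    · exact absurd hw (hdisj j hj v hv w hw')
    · have : v = v' := by
        rcases Sym2.mem_iff.1 hw with rfl | rfl <;> rcases Sym2.mem_iff.1 hw' with h1 | h1
        · exact h1
        · exact absurd (hS w hv).1 (h1 ▸ hfl v' hv')
        · exact absurd (hS v' hv').1 (h1 ▸ hfl v hv)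
        · obtain ⟨a, ha⟩ := Set.ncard_eq_one.1 (hf v hv).2
          have h2 : v ∈ (tree s).neighborSet (f v) := (hf v hv).1.symm
          have h3 : v' ∈ (tree s).neighborSet (f v) := h1 ▸ (hf v' hv').1.symm
          rw [ha, Set.mem_singleton_iff] at h2 h3
          rw [h2, h3]
      rw [this]

/-- Each vertex outside the independent set lies on a matching edge, and no matching edge contains
two such vertices; so there are at least as many edges as such vertices. -/
theorem card_le_ncard (h : Final s m) {x y : Fin n} {P : (tree s).Walk x y} (hP : P.IsPath)
    {S : Set (Fin n)} {f : Fin n → Fin n} (hx : x.val + 1 < eta s m) (hy : y.val + 1 = hub s (m - 1))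
    (hm : 0 < m) (hf : ∀ v ∈ S, IsLeafAt (tree s) v (f v))
    (hM : IsEdgeMatching (tree s) (pathMatching P S f))
    (hS1 : ∀ v, low s m ≤ v.val + 1 → v ∉ P.support → v ∈ S)
    (hS2 : eta s m < low s m → y ∈ S) : n ≤ (pathMatching P S f).ncard + (indepSet s m).card := by
  classical
  have hye := h.hub_lt_eta (show m - 1 < m by omega)
  have hel := h.eta_le_low
  -- Top vertices of `P` stand at odd positions, hence are covered by its odd-numbered edges. The
  -- loop `s(v, v)` is a dummy value.
  have hcov : ∀ v, ∃ e, v ∉ indepSet s m → e ∈ pathMatching P S f ∧ v ∈ e := by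
    intro v
    by_cases hv : v ∈ indepSet s m
    · exact ⟨s(v, v), fun h => absurd hv h⟩
    suffices h : ∃ e ∈ pathMatching P S f, v ∈ e from h.imp fun e he _ => he
    by_cases hlow : low s m ≤ v.val + 1
    · by_cases hvP : v ∈ P.support
      · obtain ⟨i, rfl, hi⟩ := SimpleGraph.Walk.mem_support_iff_exists_getVert.1 hvP
        have h1 := (h.getVert_lt_iff P hx hi).not.1 (by omega)
        rw [Nat.not_even_iff_odd] at h1
        obtain ⟨j, rfl⟩ := h1
        exact ⟨_, Or.inl ⟨j, hi, rfl⟩, by simp⟩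
      · exact ⟨_, Or.inr ⟨v, hS1 v hlow hvP, rfl⟩, by simp⟩
    · rw [mem_indepSet] at hv
      have h1 : eta s m < low s m ∧ v.val + 1 = hub s (m - 1) := by
        by_contra h1
        exact hv ⟨not_le.1 hlow, h1⟩
      obtain rfl : v = y := Fin.ext (by omega)
      exact ⟨_, Or.inr ⟨v, hS2 h1.1, rfl⟩, by simp⟩
  have hint : ∀ v, v ∉ indepSet s m → low s m ≤ v.val + 1 ∨ v = y := by
    intro v hv
    rw [mem_indepSet] at hv
    by_cases hlow : low s m ≤ v.val + 1
    · exact Or.inl hlow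
    · refine Or.inr (Fin.ext ?_)
      by_contra h1
      exact hv ⟨by omega, fun h2 => h1 (by omega)⟩
  have hint' : ∀ v, v ∉ indepSet s m → Internal s m v := by
    intro v hv
    rcases hint v hv with h1 | rfl
    · exact Or.inl h1
    · exact internal_hub (by omega) hy
  have huniq : ∀ u v, u ∉ indepSet s m → v ∉ indepSet s m → u ≠ v →
      s(u, v) ∉ pathMatching P S f := by
    have key : ∀ v, low s m ≤ v.val + 1 → s(y, v) ∉ pathMatching P S f := by
      rintro v hv (⟨i, hi, h1⟩ | ⟨w, hw, h1⟩)
      · rcases Sym2.eq_iff.1 h1 with ⟨h2, -⟩ | ⟨h2, h3⟩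
        · have := (hP.getVert_eq_end_iff (show 2 * i ≤ P.length by omega)).1 h2.symm
          omega
        · have := (h.getVert_lt_iff P hx hi).1 (by rw [← h2]; omega)
          exact absurd this (by simp)
      · have h2 := h.leaf_iff.1 (hf w hw).2
        rcases Sym2.eq_iff.1 h1 with ⟨-, h3⟩ | ⟨h3, -⟩
        · rw [← h3] at h2
          exact h2 (Or.inl hv)
        · rw [← h3] at h2
          exact h2 (internal_hub (by omega) hy)
    intro u v hu hv huv hmem
    have hadj : (tree s).Adj u v := hM.1 hmem
    have h1 := h.lt_iff_of_adj hadj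
    rcases hint u hu with h2 | rfl <;> rcases hint v hv with h3 | rfl
    · omega
    · rw [Sym2.eq_swap] at hmem
      exact key u h2 hmem
    · exact key v h3 hmem
    · exact huv rfl
  choose g hg using hcov
  have h1 : (indepSet s m)ᶜ.card ≤ (pathMatching P S f).ncard := by
    rw [← Set.ncard_coe_finset]
    refine Set.ncard_le_ncard_of_injOn g (fun v hv => (hg v (by simpa using hv)).1) ?_ (Set.toFinite _)
    intro u hu v hv huv
    have hu' : u ∉ indepSet s m := by simpa using hu
    have hv' : v ∉ indepSet s m := by simpa using hv
    by_contra hne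
    refine huniq u v hu' hv' hne ?_
    have := (Sym2.mem_and_mem_iff hne).1 ⟨(hg u hu').2, huv ▸ (hg v hv').2⟩
    rw [← this]
    exact (hg u hu').1
  have h2 := Finset.card_add_card_compl (indepSet s m)
  rw [Fintype.card_fin] at h2
  omega

theorem exists_isLeafAt_last (h : Final s m) (hlt : eta s m < low s m) {y : Fin n}
    (hy : y.val + 1 = hub s (m - 1)) : ∃ u, IsLeafAt (tree s) y u := by
  have hm := h.pos_of_eta_lt hlt
  have h0 := h.low_le
  have h1 := h.hub_lt_eta (show m - 1 < m by omega)
  have h2 := h.low_le_eta (show m - 1 < m by omega)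
  obtain ⟨u, hu⟩ := exists_vertex (n := n) (p := low s m - 1) (by omega) (by omega)
  refine ⟨u, ?_, ?_⟩
  · rw [h.adj_iff_of_lt (by omega) (by omega)]
    exact Or.inl ⟨m - 1, by omega, hy, by rw [Nat.sub_add_cancel hm]; omega, by omega⟩
  · rw [h.leaf_iff]
    rintro (h3 | ⟨r, hr, h3⟩)
    · omega
    · have := h.hub_lt_eta hr
      omega

/-- For `v_n` the leaf is `v_1`, as every hub has index at least `kap n = d_n ≥ 2`. For another
processed `v_j` it is the last child `kap j`: since `kap` is injective there, this is a hub `kap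
(eta r)` only if `j = eta r`. -/
theorem exists_isLeafAt (h : Final s m) {v : Fin n} (hv : low s m ≤ v.val + 1)
    (hne : ∀ r < m, 0 < r → v.val + 1 ≠ eta s r) : ∃ u, IsLeafAt (tree s) v u := by
  have hel := h.eta_le_low
  have key : ∀ c, 1 ≤ c → c < eta s m → Joined s m c (v.val + 1) → (∀ r < m, c ≠ hub s r) →
      ∃ u, IsLeafAt (tree s) v u := by
    intro c hc1 hc2 hj hr
    obtain ⟨u, hu⟩ := exists_vertex (n := n) hc1 (by have := eta_le_n s m; omega)
    refine ⟨u, ((h.adj_iff_of_lt (by omega) (by omega)).2 (hu ▸ hj)).symm, ?_⟩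
    rw [h.leaf_iff]
    rintro (h3 | ⟨r, hr', h3⟩)
    · omega
    · exact hr r hr' (by omega)
  by_cases hvn : v.val + 1 = n
  · have h1 := h.kap_n
    have h2 := h.two_le_entry (p := n) (by have := h.leaves_lt_low; omega) le_rfl
    have h3 := h.kap_lt_eta h.low_le (by omega)
    refine key 1 le_rfl (by omega) (Or.inr ⟨hv, by rw [hvn]; omega, Or.inl hvn⟩) fun r hr => ?_
    have h4 := h.kap_le (h.low_le_eta hr) (eta_le_n s r) (by omega)
    change kap s n ≤ hub s r at h4
    omega
  · refine key (kap s (v.val + 1)) (h.one_le_kap (by omega)) (h.kap_lt_eta hv (by omega))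
      (Or.inr ⟨hv, le_rfl, Or.inr (h.kap_lt hv (by omega) (by omega))⟩) fun r hr heq => ?_
    have hr0 : r ≠ 0 := by
      rintro rfl
      have h1 := h.kap_lt hv (show v.val + 1 < n by omega) (by omega)
      rw [hub, h.eta_zero] at heq
      omega
    have h2 := hne r hr (by omega)
    have h3 := h.low_le_eta hr
    have h4 := eta_le_n s r
    rw [hub] at heq
    rcases lt_or_gt_of_ne h2 with h5 | h5
    · have := h.kap_lt hv h5 (by omega)
      omega
    · have := h.kap_lt h3 h5 (by omega)
      omega

/-- The path is `hub 0, eta 1, hub 1, eta 2, …, hub r`. The two vertices added at each step have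
indices strictly between `hub r` and `eta r`, an interval that the earlier path avoids. Hence it
passes exactly through the vertices that `exists_isLeafAt` leaves out. -/
theorem exists_path (h : Final s m) (r : ℕ) (hr : r < m) : ∃ (x z : Fin n)
    (P : (tree s).Walk x z), x.val + 1 = hub s 0 ∧ z.val + 1 = hub s r ∧ P.IsPath ∧
      (∀ w ∈ P.support, w.val + 1 ≤ hub s r ∨ eta s r ≤ w.val + 1) ∧
      ∀ w : Fin n, ∀ i ≤ r, 0 < i → w.val + 1 = eta s i → w ∈ P.support := by
  induction r with
  | zero =>
    obtain ⟨x, hx⟩ := exists_vertex (h.one_le_hub 0) (h.hub_le hr)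
    refine ⟨x, x, .nil, hx, hx, .nil, ?_, fun w i hi hi' => by omega⟩
    intro w hw
    rw [SimpleGraph.Walk.support_nil, List.mem_singleton] at hw
    rw [hw]
    omega
  | succ r ih =>
    obtain ⟨x, z, P, hx, hz, hP, h1, h2⟩ := ih (by omega)
    have h3 := h.hub_lt_hub (show r < r + 1 by omega) hr
    have h4 := h.eta_lt (show r < r + 1 by omega) hr.le
    have h5 := h.hub_lt_eta hr
    have h6 := h.eta_le hr.le le_rfl
    have h7 := eta_le_n s (r + 1)
    obtain ⟨j, hj⟩ := exists_vertex (n := n) (p := eta s (r + 1)) (by omega) h7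
    obtain ⟨z', hz'⟩ := exists_vertex (h.one_le_hub (r + 1)) (h.hub_le hr)
    have hzj : (tree s).Adj z j := by
      rw [h.adj_iff_of_lt (by omega) (by omega), hz, hj]
      exact Or.inl ⟨r, by omega, rfl, le_rfl, h4⟩
    have hjz : (tree s).Adj j z' := by
      rw [SimpleGraph.adj_comm, h.adj_iff_of_lt (by omega) (by omega), hz', hj]
      exact h.joined_hub hr
    have hjP : j ∉ P.support := fun hmem => by
      have := h1 j hmem
      omega
    have hzP : z' ∉ (P.concat hzj).support := fun hmem => by
      rw [SimpleGraph.Walk.support_concat, List.mem_append, List.mem_singleton] at hmem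
      rcases hmem with hmem | rfl
      · have := h1 z' hmem
        omega
      · omega
    refine ⟨x, z', (P.concat hzj).concat hjz, hx, hz', (hP.concat hjP hzj).concat hzP hjz, ?_, ?_⟩
    · intro w hw
      simp only [SimpleGraph.Walk.support_concat, List.mem_append, List.mem_singleton] at hw
      rcases hw with (hw | rfl) | rfl
      · have := h1 w hw
        omega
      · omega
      · omega
    · intro w i hi hi' hw
      simp only [SimpleGraph.Walk.support_concat, List.mem_append, List.mem_singleton]
      by_cases hir : i = r + 1
      · subst hir
        exact Or.inl (Or.inr (Fin.ext (by omega)))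
      · exact Or.inl (Or.inl (h2 w i (by omega) hi' hw))

theorem exists_isAlgorithmMatching (h : Final s m) (hne : (setVK s).Nonempty) :
    ∃ M, IsAlgorithmMatching s M := by
  classical
  obtain ⟨v, hv⟩ := hne
  obtain ⟨r, hr, -⟩ := h.mem_setVK.1 hv
  have hm : 0 < m := by omega
  obtain ⟨x, y, P, hx, hy, hP, -, hsupp⟩ := h.exists_path (m - 1) (by omega)
  refine ⟨_, x, y, P, fun v => if hv : ∃ u, IsLeafAt (tree s) v u then hv.choose else v,
    by rw [h.head?_VK hm, hx], by rw [h.getLast?_VK hm, hy], hP, ?_, rfl⟩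
  intro w hw
  have hleaf : ∃ u, IsLeafAt (tree s) w u := by
    rcases hw with ⟨⟨u, hu, hadj⟩, hwP, hwi⟩ | ⟨rfl, hu⟩
    · obtain ⟨r', hr', hu'⟩ := h.mem_setVK.1 hu
      have h1 := h.hub_lt_eta hr'
      have h2 := (h.lt_iff_of_adj hadj).1 (by omega)
      refine h.exists_isLeafAt ?_ fun i hi hi' hwe => hwP (hsupp w i (by omega) hi' hwe)
      rcases h.internal_iff.1 hwi with h3 | ⟨i, hi, h3⟩
      · exact h3
      · have := h.hub_lt_eta hi
        omega
    · exact hu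
  simp only [hleaf, dite_true]
  exact hleaf.choose_spec

theorem isAlgorithmMatching_spec (h : Final s m) {M : Set (Sym2 (Fin n))}
    (hM : IsAlgorithmMatching s M) :
    IsEdgeMatching (tree s) M ∧ M.ncard = matchingNumber (tree s) := by
  obtain ⟨x, y, P, f, hx, hy, hP, hf, rfl⟩ := hM
  have hm : 0 < m := by
    by_contra hm
    obtain rfl : m = 0 := by omega
    rw [h.VK_eq] at hx
    simp at hx
  rw [h.head?_VK hm, Option.some_inj] at hx
  rw [h.getLast?_VK hm, Option.some_inj] at hy
  have hx0 := h.hub_lt_eta hm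
  have hy0 := h.hub_lt_eta (show m - 1 < m by omega)
  have hyi : Internal s m y := internal_hub (show m - 1 < m by omega) hy.symm
  have hel := h.eta_le_low
  have hmat := h.isEdgeMatching hP (f := f) (by omega) (by omega) (internal_hub hm hx.symm) hyi
    (fun v hv => ?_) hf
  · refine ⟨hmat, ?_⟩
    have h1 := h.card_le_ncard hP (by omega) hy.symm hm hf hmat ?_ ?_
    · have h2 := hmat.ncard_le
      have h3 := matchingNumber_add_card_le h.isIndepSet
      rw [Fintype.card_fin] at h3
      exact le_antisymm h2 (show matchingNumber (tree s) ≤ (pathMatching P _ f).ncard by omega)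
    · intro v hv hvP
      refine Or.inl ⟨?_, hvP, h.internal_iff.2 (Or.inl hv)⟩
      -- Every processed vertex has a neighbour in `V_K`: its own hub or, for `v_n`, its child `hub
      -- 0`.
      have key : ∀ r < m, Joined s m (hub s r) (v.val + 1) →
          ∃ u ∈ setVK s, (tree s).Adj u v := by
        intro r hr hj
        obtain ⟨u, hu⟩ := exists_vertex (h.one_le_hub r) (h.hub_le hr)
        have := h.hub_lt_eta hr
        refine ⟨u, h.mem_setVK.2 ⟨r, hr, hu⟩, ?_⟩
        rw [h.adj_iff_of_lt (by omega) (by omega), hu]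
        exact hj
      by_cases hvn : v.val + 1 = n
      · refine key 0 hm ?_
        rw [hvn]
        simpa only [h.eta_zero] using h.joined_hub hm
      · obtain ⟨r, hr, h3, h4⟩ := h.exists_round (j := v.val + 1) (by omega) (by omega)
        exact key r hr (Or.inl ⟨r, hr, rfl, h3, h4⟩)
    · intro hlt
      exact Or.inr ⟨rfl, h.exists_isLeafAt_last hlt hy.symm⟩
  · rcases hv with ⟨-, hvP, hvi⟩ | ⟨rfl, -⟩
    · exact ⟨h.internal_iff.1 hvi, fun hmem => absurd hmem hvP⟩
    · exact ⟨hyi, fun _ => rfl⟩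

end Final

/-! ### Small cases and assembly -/

theorem exists_final (hs : IsTreeDegreeSequence s) (hn : 3 ≤ n) : ∃ m, Final s m := by
  have hpos := hs.pos (by omega)
  have hsum := hs.sum_eq
  have h1 := sum_filter_lt_eq (s := s) (le_refl n) hpos
  have h2 : (Finset.univ.filter fun i : Fin n => i.val < n) = Finset.univ :=
    Finset.filter_true_of_mem fun i _ => i.2
  rw [h2] at h1
  obtain ⟨m, h3, h4⟩ := exists_inv_run hs.mono hpos (by omega) hn
  exact ⟨m, hs.mono, hpos, hsum, by omega, hn, h3, h4⟩

theorem run_eq_start (ht : (start s).t = n) : run s = start s := by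
  have : ∀ r, (outerStep s)^[r] (start s) = start s := fun r => by
    induction r with
    | zero => rfl
    | succ r ih => rw [Function.iterate_succ_apply', ih, outerStep_of_eq ht]
  exact this n

/-- For `n ≤ 2` the closed form does not apply, since it needs `d_n ≥ 2`; here the initial star is
already the whole output. -/
theorem tree_mem_of_le_two (hs : IsTreeDegreeSequence s) (hn : n < 3) :
    tree s ∈ treesWithDegrees s ∧ annihilationNumber s ≤ (tree s).indepNum ∧
      (run s).VK = [] := by
  classical
  have hsum := hs.sum_eq
  have hind : ∀ v : Fin n, 1 ≤ (tree s).indepNum := fun v => by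
    have := SimpleGraph.IsIndepSet.card_le_indepNum (G := tree s) (t := {v}) (by simp)
    simpa using this
  obtain rfl | rfl | rfl : n = 0 ∨ n = 1 ∨ n = 2 := by omega
  · simp at hsum
  · have hs0 : s 0 = 0 := by simpa using hsum
    have hrun : run s = start s := run_eq_start (by
      change entry s 1 + 1 = 1
      rw [entry_of_mem (by omega)]
      simp [hs0])
    refine ⟨⟨.of_subsingleton, ?_⟩, (Nat.findGreatest_le 1).trans (hind 0), by rw [hrun]; rfl⟩
    refine Multiset.map_congr rfl fun v _ => ?_
    rw [Subsingleton.elim v 0, hs0, SimpleGraph.degree_eq_zero_iff_notMem_support,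
      SimpleGraph.mem_support]
    rintro ⟨w, hw⟩
    exact hw.ne (Subsingleton.elim _ _)
  · have h0 := hs.pos (by omega) 0
    have h1 := hs.pos (by omega) 1
    rw [Fin.sum_univ_two] at hsum
    have hs1 : ∀ v, s v = 1 := by
      intro v
      fin_cases v <;> simp <;> omega
    have he : entry s 2 = 1 := by
      rw [entry_of_mem (by omega), hs1]
    have hrun : run s = start s := run_eq_start (by
      change entry s 2 + 1 = 2
      rw [he])
    have htop : tree s = ⊤ := by
      have h01 : (tree s).Adj 0 1 := by
        rw [tree, SimpleGraph.fromRel_adj, hrun, start, he]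
        simp
      ext u v
      fin_cases u <;> fin_cases v <;> simp [h01, h01.symm]
    have hconn : (tree s).Connected := htop ▸ SimpleGraph.connected_top
    refine ⟨⟨⟨hconn, .of_card_le_two (by simp)⟩, ?_⟩, ?_, by rw [hrun]; rfl⟩
    · refine Multiset.map_congr rfl fun v _ => ?_
      rw [hs1]
      have hd : ∀ G : SimpleGraph (Fin 2), G = ⊤ → ∀ [Fintype (G.neighborSet v)],
          G.degree v = 1 := by
        rintro G rfl _
        convert SimpleGraph.complete_graph_degree v
        rfl
      exact hd _ htop
    · refine le_trans ?_ (hind 0)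
      have ha : annihilationNumber s ≤ 2 := Nat.findGreatest_le 2
      have ha2 : 2 * ∑ i with i.val < annihilationNumber s, s i ≤ ∑ i, s i :=
        Nat.findGreatest_spec (P := fun a => 2 * ∑ i with i.val < a, s i ≤ ∑ i, s i)
          (Nat.zero_le 2) (by simp)
      rw [sum_filter_lt_eq ha (hs.pos (by omega)), Fin.sum_univ_two] at ha2
      omega

end MaxNullity

theorem mainTheorem2 (n : ℕ) (s : Fin n → ℕ) (hs : IsTreeDegreeSequence s) :
    -- the three extremal values over all trees with degree sequence `s`
    IsLeast ((fun T => (matchingNumber T : ℤ)) '' treesWithDegrees s)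
      ((n : ℤ) - annihilationNumber s) ∧
    IsGreatest ((fun T => (graphNullity T : ℤ)) '' treesWithDegrees s)
      (2 * (annihilationNumber s : ℤ) - n) ∧
    IsGreatest (SimpleGraph.indepNum '' treesWithDegrees s) (annihilationNumber s) ∧
    -- all three are attained by the output of the algorithm
    MaxNullity.tree s ∈ treesWithDegrees s ∧
    (matchingNumber (MaxNullity.tree s) : ℤ) = (n : ℤ) - annihilationNumber s ∧
    (graphNullity (MaxNullity.tree s) : ℤ) = 2 * (annihilationNumber s : ℤ) - n ∧
    (MaxNullity.tree s).indepNum = annihilationNumber s ∧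
    -- the accompanying matchings exist and are maximum matchings
    ((MaxNullity.setVK s).Nonempty → ∃ M, MaxNullity.IsAlgorithmMatching s M) ∧
    ∀ M : Set (Sym2 (Fin n)), MaxNullity.IsAlgorithmMatching s M →
      (∃ M' : (MaxNullity.tree s).Subgraph, M'.IsMatching ∧ M'.edgeSet = M) ∧
      M.ncard = matchingNumber (MaxNullity.tree s) := by
  have htree : ∀ T ∈ treesWithDegrees s, T.indepNum ≤ annihilationNumber s ∧
      matchingNumber T + T.indepNum = n ∧ graphNullity T + n = 2 * T.indepNum := by
    rintro T ⟨hT, hdeg⟩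
    have h1 := hT.isAcyclic.matchingNumber_add_indepNum
    have h2 := hT.isAcyclic.graphNullity_add_card
    rw [Fintype.card_fin] at h1 h2
    exact ⟨hdeg.indepNum_le hs.mono, h1, h2⟩
  obtain ⟨hmem, hle, hex, hspec⟩ : MaxNullity.tree s ∈ treesWithDegrees s ∧
      annihilationNumber s ≤ (MaxNullity.tree s).indepNum ∧
      ((MaxNullity.setVK s).Nonempty → ∃ M, MaxNullity.IsAlgorithmMatching s M) ∧
      ∀ M : Set (Sym2 (Fin n)), MaxNullity.IsAlgorithmMatching s M →
        IsEdgeMatching (MaxNullity.tree s) M ∧ M.ncard = matchingNumber (MaxNullity.tree s) := by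
    by_cases hn : 3 ≤ n
    · obtain ⟨m, h⟩ := MaxNullity.exists_final hs hn
      exact ⟨⟨h.isTree, h.hasDegreeSequence⟩,
        h.annihilationNumber_le.trans h.isIndepSet.card_le_indepNum,
        h.exists_isAlgorithmMatching, fun M hM => h.isAlgorithmMatching_spec hM⟩
    · obtain ⟨h1, h2, h3⟩ := MaxNullity.tree_mem_of_le_two hs (not_le.1 hn)
      refine ⟨h1, h2, ?_, ?_⟩
      · rintro ⟨v, hv⟩
        change v.val + 1 ∈ (MaxNullity.run s).VK at hv
        simp [h3] at hv
      · rintro M ⟨x, y, P, f, hx, -⟩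
        simp [h3] at hx
  obtain ⟨h1, h2, h3⟩ := htree _ hmem
  have hindep := le_antisymm h1 hle
  have hmatch : (matchingNumber (MaxNullity.tree s) : ℤ) = (n : ℤ) - annihilationNumber s := by
    omega
  have hnull : (graphNullity (MaxNullity.tree s) : ℤ) = 2 * (annihilationNumber s : ℤ) - n := by
    omega
  refine ⟨⟨⟨_, hmem, hmatch⟩, ?_⟩, ⟨⟨_, hmem, hnull⟩, ?_⟩, ⟨⟨_, hmem, hindep⟩, ?_⟩, hmem, hmatch,
    hnull, hindep, hex, fun M hM => ⟨(hspec M hM).1.exists_subgraph, (hspec M hM).2⟩⟩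
  · rintro _ ⟨T, hT, rfl⟩
    obtain ⟨h4, h5, -⟩ := htree T hT
    simp only
    omega
  · rintro _ ⟨T, hT, rfl⟩
    obtain ⟨h4, -, h5⟩ := htree T hT
    simp only
    omega
  · rintro _ ⟨T, hT, rfl⟩
    exact (htree T hT).1
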